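/- **Proposition 3 (Hölder continuity of the Hermite sheet).** Let $d,q\ge 1$ be integers, $\mathbf H=(H_1,\dots,H_d)\in(\tfrac12,1)^d$, $c>0$, and let $(W(\mathbf y))_{\mathbf y\in\mathbb R^d}$ be a standard Brownian sheet on a probability space $(\Omega,\mathcal F,P)$, i.e. a centred Gaussian process vanishing on the coordinate hyperplanes with covariance $\mathbb E[W(\mathbf s)W(\mathbf t)]=\prod_{i=1}^d\frac{|s_i|+|t_i|-|s_i-t_i|}{2}$ (which equals $\prod_i s_i\wedge t_i$ for $\mathbf s,\mathbf t\ge 0$). Let $(Z(\mathbf t))_{\mathbf t\ge 0}$ be the Hermite sheet of order $q$ with Hurst multi-index $\mathbf H$ and normalization constant $c$, i.e. for every $\mathbf t\ge 0$, almost surely, $$Z(\mathbf t)=c\int_{(\mathbb R^{d})^q}\Big(\int_{[0,t_1]\times\cdots\times[0,t_d]}\prod_{j=1}^q\prod_{i=1}^d (s_i-y_{i,j})_+^{-\left(\frac12+\frac{1-H_i}{q}\right)}\,d\mathbf s\Big)\,dW(\mathbf y_1)\cdots dW(\mathbf y_q),$$ a multiple Wiener–Itô integral of order $q$ with respect to $W$,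 where $\mathbf y_j=(y_{1,j},\dots,y_{d,j})$. For $X:\mathbb R^d\to\mathbb R$ write $$\Delta X_{[\mathbf s,\mathbf t]}=\sum_{\mathbf r\in\{0,1\}^d}(-1)^{d-\sum_i r_i}X\big(s_1+r_1(t_1-s_1),\dots,s_d+r_d(t_d-s_d)\big).$$ Then $Z$ has a modification $Z'$ on $\{\mathbf t\ge 0\}$ all of whose trajectories are continuous and Hölder continuous of every order $\boldsymbol\delta=(\delta_1,\dots,\delta_d)$ with $0\le\delta_i<H_i$ for all $i$, in the following sense: for every $\omega\in\Omega$ and every $N>0$ there is a constant $C=C_{\omega,N,\boldsymbol\delta}>0$ such that for all $\mathbf s,\mathbf t\in[0,N]^d$, $$\big|\Delta Z'_{[\mathbf s,\mathbf t]}(\omega)\big|\le C\,|t_1-s_1|^{\delta_1}\cdots|t_d-s_d|^{\delta_d}.$$ -/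

import Mathlib

open MeasureTheory ProbabilityTheory Filter Topology
open scoped ENNReal

/-- The increment `ΔX_[s,t]` of a function of `d` real parameters on the rectangle `[s,t]`:
the alternating sum of the values of `X` at the vertices. The vertex `s + r (t - s)`,
`r ∈ {0,1}^d`, is written as the point with coordinates `t i` for `i ∈ A` and `s i` for `i ∉ A`,
where `A = {i | r i = 1}`. -/
noncomputable def rectIncrement {d : ℕ} (X : (Fin d → ℝ) → ℝ) (s t : Fin d → ℝ) : ℝ :=
  ∑ A : Finset (Fin d), (-1 : ℝ) ^ (d - A.card) * X (A.piecewise t s)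

/-- The standard Brownian sheet with parameter set all of `ℝ^d`: the centred Gaussian process
vanishing on the coordinate hyperplanes whose covariance is
`∏ i, (|s i| + |t i| - |s i - t i|) / 2`. Each factor is `min |s i| |t i|` if `s i`, `t i` have the
same sign and `0` otherwise, so the covariance is `∏ i, min (s i) (t i)` for `s, t ≥ 0`. -/
structure IsBrownianSheet {Ω : Type*} [MeasurableSpace Ω] {d : ℕ}
    (W : (Fin d → ℝ) → Ω → ℝ) (P : Measure Ω) : Prop where
  gaussian : IsGaussianProcess W P
  centered : ∀ t, ∫ ω, W t ω ∂P = 0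
  covariance : ∀ s t, ∫ ω, W s ω * W t ω ∂P = ∏ i, (|s i| + |t i| - |s i - t i|) / 2
  zero_on_axes : ∀ t, (∃ i, t i = 0) → ∀ᵐ ω ∂P, W t ω = 0

/-- The half-open rectangle `∏ i, (a i, b i]`. -/
def halfOpenBox {d : ℕ} (a b : Fin d → ℝ) : Set (Fin d → ℝ) :=
  Set.univ.pi fun i => Set.Ioc (a i) (b i)

/-- Elementary integrands of order `q`: functions
`∑ coeff (k₁, …, k_q) 1_{A_{k₁} × ⋯ × A_{k_q}}` on `(ℝ^d)^q`, where `A_0, …, A_{n-1}` are pairwise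
disjoint bounded half-open rectangles and the coefficients vanish as soon as two of the indices
`k₁, …, k_q` agree. -/
structure ElementaryIntegrand (d q : ℕ) where
  n : ℕ
  lower : Fin n → Fin d → ℝ
  upper : Fin n → Fin d → ℝ
  lower_le_upper : ∀ k i, lower k i ≤ upper k i
  disjoint : ∀ k l, k ≠ l →
    Disjoint (halfOpenBox (lower k) (upper k)) (halfOpenBox (lower l) (upper l))
  coeff : (Fin q → Fin n) → ℝ
  coeff_diagonal : ∀ κ, ¬ Function.Injective κ → coeff κ = 0

/-- The function on `(ℝ^d)^q` given by an elementary integrand. -/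
noncomputable def ElementaryIntegrand.eval {d q : ℕ} (F : ElementaryIntegrand d q)
    (y : Fin q → Fin d → ℝ) : ℝ :=
  ∑ κ : Fin q → Fin F.n, F.coeff κ *
    ∏ j, (halfOpenBox (F.lower (κ j)) (F.upper (κ j))).indicator (fun _ => (1 : ℝ)) (y j)

/-- The multiple integral of an elementary integrand,
`∑ coeff (k₁, …, k_q) W(A_{k₁}) ⋯ W(A_{k_q})`, where `W(A)` is the increment of `W` on `A`. -/
noncomputable def ElementaryIntegrand.integral {Ω : Type*} {d q : ℕ} (F : ElementaryIntegrand d q)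
    (W : (Fin d → ℝ) → Ω → ℝ) (ω : Ω) : ℝ :=
  ∑ κ : Fin q → Fin F.n, F.coeff κ *
    ∏ j, rectIncrement (fun u => W u ω) (F.lower (κ j)) (F.upper (κ j))

/-- `X` is (a version of) the multiple Wiener-Itô integral of order `q`
`∫ f(y₁, …, y_q) dW(y₁) ⋯ dW(y_q)` of `f ∈ L²((ℝ^d)^q)`: the `L²(P)` limit of the integrals of
elementary integrands that converge to `f` in `L²((ℝ^d)^q)`. -/
structure IsMultipleWienerIntegral {Ω : Type*} [MeasurableSpace Ω] {d q : ℕ}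
    (W : (Fin d → ℝ) → Ω → ℝ) (P : Measure Ω) (f : (Fin q → Fin d → ℝ) → ℝ) (X : Ω → ℝ) :
    Prop where
  memLp_integrand : MemLp f 2 volume
  memLp : MemLp X 2 P
  exists_approx : ∃ F : ℕ → ElementaryIntegrand d q,
    Tendsto (fun m => eLpNorm (fun y => (F m).eval y - f y) 2 volume) atTop (𝓝 0) ∧
    Tendsto (fun m => eLpNorm (fun ω => (F m).integral W ω - X ω) 2 P) atTop (𝓝 0)

/-- The kernel of the Hermite sheet at `t ≥ 0`:
`∫_[0,t] ∏ j, ∏ i, (s i - y j i)₊ ^ (-(1/2 + (1 - H i)/q)) ds`. The exponents are nonzero for the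
parameters of interest, and then the power of `0` is `0`, as it should be for `s i ≤ y j i`. -/
noncomputable def hermiteKernel {d : ℕ} (q : ℕ) (H : Fin d → ℝ) (t : Fin d → ℝ)
    (y : Fin q → Fin d → ℝ) : ℝ :=
  ∫ s in Set.Icc 0 t, ∏ j, ∏ i, (max (s i - y j i) 0) ^ (-(1 / 2 + (1 - H i) / (q : ℝ)))

/-- `Z` is a Hermite sheet `(Z(t), t ≥ 0)` of order `q` with Hurst multi-index `H` and
normalization constant `c`, driven by `W`: for every `t ≥ 0`,
`Z(t) = c ∫ (hermiteKernel q H t) dW ⋯ dW` almost surely. -/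
def IsHermiteSheet {Ω : Type*} [MeasurableSpace Ω] {d : ℕ} (W : (Fin d → ℝ) → Ω → ℝ)
    (P : Measure Ω) (q : ℕ) (H : Fin d → ℝ) (c : ℝ) (Z : (Fin d → ℝ) → Ω → ℝ) : Prop :=
  ∀ t, 0 ≤ t → ∃ X : Ω → ℝ,
    IsMultipleWienerIntegral W P (hermiteKernel q H t) X ∧ ∀ᵐ ω ∂P, Z t ω = c * X ω

/-! Three ingredients are combined: an exact scaling of second moments, equivalence of all moments
on a fixed Wiener chaos, and a Kolmogorov criterion for rectangular increments.

Second moments. By linearity, the increment of `Z` over a box is `c` times the multiple integral of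
the increment of the kernel. The kernel is a product over the coordinates, so its increment is a
product of one-dimensional increments, each dominated by the integral over the side `(s_i, t_i]` of
`∏ j, (u - y j i)₊ ^ (-a_i)`, where `a_i = 1/2 + (1 - H_i)/q`. Expanding the square and applying
Tonelli, the squared `L²` norm becomes a product over `i` of double integrals of the `q`-th power of
the correlation `∫ (u-x)₊^(-a_i) (v-x)₊^(-a_i) dx`. That correlation is at most a constant times
`|u-v|^(1-2a_i)`, and `q(1-2a_i) = 2H_i - 2 > -1`, so each factor is of order `|t_i-s_i|^(2H_i)`
(`eLpNorm_rectIncrement_hermiteKernel_le`).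

Higher moments. On the chaos of order `q` the `L^(2m)` norm is bounded by a constant times the `L²`
norm of the integrand. For elementary integrands, refining all boxes to one grid gives an
off-diagonal polynomial in independent Gaussian variables, linear in each of them.
Hypercontractivity for such polynomials follows by adjoining the variables one at a time
(`integral_multilinear_gaussian_pow_le`). Fatou's lemma carries the bound to general integrands
(`IsBrownianSheet.eLpNorm_sum_wiener_le`). Hence the `L^(2m)` norm of an increment of `Z` is at most
`C ∏ |t_i-s_i|^(H_i)` for every `m`.

Paths. If `2m(H_i - δ_i) > 1` for all `i`, the normalised `2m`-th powers of the increments over all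
dyadic cells, with independent levels in the different coordinates, have a finite expected sum, so
almost surely a single constant bounds them all. One-dimensional chaining, applied to one coordinate
after another, extends the bound to boxes with dyadic corners
(`abs_rectIncrement_le_of_dyadicPair`). Since the sheet vanishes on the coordinate hyperplanes,
differences of its values are sums of rectangular increments. The dyadic values therefore extend
continuously, and mean square continuity identifies the extension as a modification
(`exists_holder_modification`). -/

/-- A function all of whose moments are finite. -/
def HasAllMoments {Ω : Type*} [MeasurableSpace Ω] (f : Ω → ℝ) (P : Measure Ω) : Prop :=
  ∀ p : ℝ≥0∞, p ≠ ∞ → MemLp f p P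

namespace HasAllMoments

variable {Ω : Type*} [MeasurableSpace Ω] {P : Measure Ω} {f g : Ω → ℝ}

lemma mul (hf : HasAllMoments f P) (hg : HasAllMoments g P) :
    HasAllMoments (fun ω => f ω * g ω) P := by
  intro p hp
  have h2 : p * 2 ≠ ∞ := ENNReal.mul_ne_top hp (by simp)
  have : ENNReal.HolderTriple (p * 2) (p * 2) p := by
    constructor
    rw [ENNReal.mul_inv (by simp) (by simp), ← mul_add, ENNReal.inv_two_add_inv_two, mul_one]
  exact (hg _ h2).mul (hf _ h2)

lemma const [IsProbabilityMeasure P] (c : ℝ) : HasAllMoments (fun _ : Ω => c) P :=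
  fun _ _ => memLp_const c

lemma pow [IsProbabilityMeasure P] (hf : HasAllMoments f P) (n : ℕ) :
    HasAllMoments (fun ω => f ω ^ n) P := by
  induction n with
  | zero => simpa using const 1
  | succ n ih => simpa [pow_succ] using ih.mul hf

lemma prod [IsProbabilityMeasure P] {ι : Type*} (T : Finset ι) {F : ι → Ω → ℝ}
    (h : ∀ k ∈ T, HasAllMoments (F k) P) : HasAllMoments (fun ω => ∏ k ∈ T, F k ω) P := by
  classical
  induction T using Finset.induction_on with
  | empty => simpa using const 1
  | insert a T ha ih =>
    simp only [Finset.prod_insert ha]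
    exact (h a (by simp)).mul (ih fun k hk => h k (by simp [hk]))

lemma sum {ι : Type*} (T : Finset ι) {F : ι → Ω → ℝ}
    (h : ∀ k ∈ T, HasAllMoments (F k) P) : HasAllMoments (fun ω => ∑ k ∈ T, F k ω) P :=
  fun p hp => memLp_finsetSum T fun k hk => h k hk p hp

lemma add (hf : HasAllMoments f P) (hg : HasAllMoments g P) :
    HasAllMoments (fun ω => f ω + g ω) P := fun p hp => (hf p hp).add (hg p hp)

lemma integrable (hf : HasAllMoments f P) : Integrable f P :=
  memLp_one_iff_integrable.1 (hf 1 (by simp))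

end HasAllMoments

/-! ### Hypercontractivity for Gaussian polynomials. -/

/-- Hölder's inequality for mixed even moments. -/
lemma integral_even_pow_mul_even_pow_le {Ω : Type*} [MeasurableSpace Ω] {P : Measure Ω}
    [IsProbabilityMeasure P] {f g : Ω → ℝ} (hf : HasAllMoments f P) (hg : HasAllMoments g P)
    {k l : ℕ} {a b : ℝ} (ha : 0 ≤ a) (hb : 0 ≤ b)
    (hfa : ∫ ω, f ω ^ (2 * (k + l)) ∂P ≤ a ^ (k + l))
    (hgb : ∫ ω, g ω ^ (2 * (k + l)) ∂P ≤ b ^ (k + l)) :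
    ∫ ω, f ω ^ (2 * k) * g ω ^ (2 * l) ∂P ≤ a ^ k * b ^ l := by
  rcases Nat.eq_zero_or_pos k with rfl | hk
  · simpa using hgb
  rcases Nat.eq_zero_or_pos l with rfl | hl
  · simpa using hfa
  have hk' : (0 : ℝ) < k := by exact_mod_cast hk
  have hl' : (0 : ℝ) < l := by exact_mod_cast hl
  -- Hölder is applied with the conjugate exponents `(k+l)/k` and `(k+l)/l`, which turn both factors
  -- into powers of order `2(k+l)`.
  have key : ∀ n : ℕ, 0 < n → ∀ x : ℝ,
      (x ^ (2 * n)) ^ (((k + l : ℕ) : ℝ) / n) = x ^ (2 * (k + l)) := by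
    intro n hn x
    have hn' : (n : ℝ) ≠ 0 := by positivity
    rw [pow_mul, ← Real.rpow_natCast, ← Real.rpow_mul (by positivity),
      mul_div_cancel₀ _ hn', Real.rpow_natCast, ← pow_mul]
  have key2 : ∀ (n : ℕ) (c I : ℝ), 0 < n → 0 ≤ c → 0 ≤ I → I ≤ c ^ (k + l) →
      I ^ (1 / (((k + l : ℕ) : ℝ) / n)) ≤ c ^ n := by
    intro n c I hn hc hI hIc
    calc I ^ (1 / (((k + l : ℕ) : ℝ) / n)) ≤ (c ^ (k + l)) ^ (1 / (((k + l : ℕ) : ℝ) / n)) := by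
          gcongr
      _ = c ^ n := by
          rw [← Real.rpow_natCast, ← Real.rpow_mul hc, ← Real.rpow_natCast]
          congr 1
          have : ((k + l : ℕ) : ℝ) ≠ 0 := by positivity
          field_simp
  have hpq : Real.HolderConjugate (((k + l : ℕ) : ℝ) / k) (((k + l : ℕ) : ℝ) / l) := by
    rw [Real.holderConjugate_iff]
    constructor
    · rw [lt_div_iff₀ hk']; push_cast; linarith
    · push_cast; field_simp
  have h := integral_mul_le_Lp_mul_Lq_of_nonneg (μ := P) hpq
    (f := fun ω => f ω ^ (2 * k)) (g := fun ω => g ω ^ (2 * l))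
    (Eventually.of_forall fun ω => by simp only [pow_mul]; positivity)
    (Eventually.of_forall fun ω => by simp only [pow_mul]; positivity)
    (hf.pow _ _ (by simp)) (hg.pow _ _ (by simp))
  simp only [key k hk, key l hl] at h
  refine h.trans (mul_le_mul (key2 k a _ hk ha ?_ hfa) (key2 l b _ hl hb ?_ hgb) ?_ (by positivity))
  · exact integral_nonneg fun ω => by simp only [pow_mul]; positivity
  · exact integral_nonneg fun ω => by simp only [pow_mul]; positivity
  · exact Real.rpow_nonneg (integral_nonneg fun ω => by simp only [pow_mul]; positivity) _

lemma integral_pow_odd_gaussianReal (v : NNReal) (k : ℕ) :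
    ∫ x, x ^ (2 * k + 1) ∂(gaussianReal 0 v) = 0 := by
  have h : ∫ x, x ^ (2 * k + 1) ∂(gaussianReal 0 v)
      = ∫ x, (-x) ^ (2 * k + 1) ∂(gaussianReal 0 v) := by
    conv_lhs => rw [← neg_zero, ← gaussianReal_map_neg]
    rw [integral_map (by fun_prop) (by fun_prop)]
  simp only [Odd.neg_pow ⟨k, rfl⟩, integral_neg] at h
  linarith

lemma integral_pow_even_gaussianReal (v : NNReal) (k : ℕ) :
    ∫ x, x ^ (2 * k) ∂(gaussianReal 0 v) = v ^ k * ∫ x, x ^ (2 * k) ∂(gaussianReal 0 1) := by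
  have h : gaussianReal 0 v = (gaussianReal 0 1).map (Real.sqrt v * ·) := by
    rw [gaussianReal_map_const_mul]
    congr 1
    · simp
    · ext; simp
  rw [h, integral_map (by fun_prop) (by fun_prop), ← integral_const_mul]
  congr 1 with x
  rw [mul_pow, pow_mul, Real.sq_sqrt (NNReal.coe_nonneg v)]

lemma sum_range_even_of_odd_eq_zero (g : ℕ → ℝ) (hg : ∀ k, g (2 * k + 1) = 0) (m : ℕ) :
    ∑ j ∈ Finset.range (2 * m + 1), g j = ∑ k ∈ Finset.range (m + 1), g (2 * k) := by
  induction m with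
  | zero => simp
  | succ m ih =>
    rw [show 2 * (m + 1) + 1 = (2 * m + 1) + 1 + 1 by ring, Finset.sum_range_succ,
      Finset.sum_range_succ, ih, hg, Finset.sum_range_succ _ (m + 1)]
    ring_nf

/-- The hypercontractivity constant for the moment of order `2m`. -/
noncomputable def hyperConst (m : ℕ) : ℝ :=
  1 + ∑ k ∈ Finset.range (m + 1), ((2 * m).choose (2 * k) : ℝ) *
    ∫ x, x ^ (2 * k) ∂(gaussianReal 0 1)

lemma integral_pow_even_nonneg (k : ℕ) : 0 ≤ ∫ x, x ^ (2 * k) ∂(gaussianReal 0 1) :=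
  integral_nonneg fun x => by simp only [pow_mul]; positivity

lemma one_le_hyperConst (m : ℕ) : 1 ≤ hyperConst m := by
  have : 0 ≤ ∑ k ∈ Finset.range (m + 1), ((2 * m).choose (2 * k) : ℝ) *
      ∫ x, x ^ (2 * k) ∂(gaussianReal 0 1) :=
    Finset.sum_nonneg fun k _ => mul_nonneg (by positivity) (integral_pow_even_nonneg k)
  unfold hyperConst; linarith

/-- Trades the even binomial coefficients of a `2m`-th power for those of an `m`-th power, so that
the even terms can be resummed by the binomial theorem. `hyperConst m` exceeds both `1` and every
left-hand side, hence so do its positive powers. -/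
lemma choose_mul_moment_le (m k : ℕ) (hk : k ≤ m) :
    ((2 * m).choose (2 * k) : ℝ) * ∫ x, x ^ (2 * k) ∂(gaussianReal 0 1)
      ≤ m.choose k * hyperConst m ^ k := by
  rcases Nat.eq_zero_or_pos k with rfl | hk0
  · simp
  have h1 : ((2 * m).choose (2 * k) : ℝ) * ∫ x, x ^ (2 * k) ∂(gaussianReal 0 1)
      ≤ hyperConst m := by
    have := Finset.single_le_sum (f := fun k => ((2 * m).choose (2 * k) : ℝ) *
      ∫ x, x ^ (2 * k) ∂(gaussianReal 0 1)) (s := Finset.range (m + 1))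
      (fun k _ => mul_nonneg (by positivity) (integral_pow_even_nonneg k))
      (Finset.mem_range.2 (Nat.lt_succ_of_le hk))
    unfold hyperConst; linarith
  have h2 : hyperConst m ≤ hyperConst m ^ k :=
    le_self_pow₀ (one_le_hyperConst m) hk0.ne'
  have h3 : (1 : ℝ) ≤ m.choose k := by exact_mod_cast Nat.choose_pos hk
  have h4 := one_le_hyperConst m
  calc _ ≤ hyperConst m ^ k := h1.trans h2
    _ ≤ _ := le_mul_of_one_le_left (by positivity) h3

/-- The moment inequality for adjoining one independent Gaussian variable. -/
lemma integral_add_gaussian_mul_pow_le {Ω : Type*} [MeasurableSpace Ω] {P : Measure Ω}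
    [IsProbabilityMeasure P] {E : Type*} [MeasurableSpace E] {x : Ω → ℝ} {Y : Ω → E} {A B : E → ℝ}
    (hA : Measurable A) (hB : Measurable B) (v : NNReal)
    (hx : AEMeasurable x P) (hxlaw : P.map x = gaussianReal 0 v) (hind : IndepFun x Y P)
    (hxm : HasAllMoments x P)
    (hAm : HasAllMoments (fun ω => A (Y ω)) P) (hBm : HasAllMoments (fun ω => B (Y ω)) P)
    (m : ℕ) {a b : ℝ} (ha : 0 ≤ a) (hb : 0 ≤ b)
    (hAa : ∫ ω, A (Y ω) ^ (2 * m) ∂P ≤ a ^ m) (hBb : ∫ ω, B (Y ω) ^ (2 * m) ∂P ≤ b ^ m) :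
    ∫ ω, (A (Y ω) + x ω * B (Y ω)) ^ (2 * m) ∂P ≤ (a + hyperConst m * v * b) ^ m := by
  have hmom : ∀ j, ∫ ω, x ω ^ j ∂P = ∫ y, y ^ j ∂(gaussianReal 0 v) := by
    intro j
    rw [← hxlaw, integral_map hx (by fun_prop)]
  have hsplit : ∀ j l, ∫ ω, x ω ^ j * (A (Y ω) ^ l * B (Y ω) ^ j) ∂P
      = (∫ y, y ^ j ∂(gaussianReal 0 v)) * ∫ ω, A (Y ω) ^ l * B (Y ω) ^ j ∂P := by
    intro j l
    rw [← hmom]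
    have hi : IndepFun (fun ω => x ω ^ j) (fun ω => A (Y ω) ^ l * B (Y ω) ^ j) P :=
      hind.comp (φ := fun y => y ^ j) (ψ := fun e => A e ^ l * B e ^ j) (by fun_prop) (by fun_prop)
    exact hi.integral_mul_eq_mul_integral (hxm.pow j).integrable.aestronglyMeasurable
      ((hAm.pow l).mul (hBm.pow j)).integrable.aestronglyMeasurable
  calc ∫ ω, (A (Y ω) + x ω * B (Y ω)) ^ (2 * m) ∂P
      = ∫ ω, ∑ j ∈ Finset.range (2 * m + 1), ((2 * m).choose j : ℝ) *
          (x ω ^ j * (A (Y ω) ^ (2 * m - j) * B (Y ω) ^ j)) ∂P := by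
        congr 1 with ω
        rw [add_comm, add_pow]
        refine Finset.sum_congr rfl fun j _ => ?_
        rw [mul_pow]; ring
    _ = ∑ j ∈ Finset.range (2 * m + 1), ((2 * m).choose j : ℝ) *
          ((∫ y, y ^ j ∂(gaussianReal 0 v)) * ∫ ω, A (Y ω) ^ (2 * m - j) * B (Y ω) ^ j ∂P) := by
        rw [integral_finsetSum]
        · refine Finset.sum_congr rfl fun j _ => ?_
          rw [integral_const_mul, hsplit]
        · intro j _
          exact (((hxm.pow j).mul ((hAm.pow _).mul (hBm.pow j))).integrable).const_mul _
    _ = ∑ k ∈ Finset.range (m + 1), ((2 * m).choose (2 * k) : ℝ) *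
          ((∫ y, y ^ (2 * k) ∂(gaussianReal 0 v)) *
            ∫ ω, A (Y ω) ^ (2 * m - 2 * k) * B (Y ω) ^ (2 * k) ∂P) := by
        -- Only even powers of `x` survive: its odd moments vanish by symmetry and factor out by
        -- independence.
        apply sum_range_even_of_odd_eq_zero (fun j => ((2 * m).choose j : ℝ) *
          ((∫ y, y ^ j ∂(gaussianReal 0 v)) * ∫ ω, A (Y ω) ^ (2 * m - j) * B (Y ω) ^ j ∂P))
        intro k
        simp [integral_pow_odd_gaussianReal]
    _ ≤ ∑ k ∈ Finset.range (m + 1),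
          (hyperConst m * v * b) ^ k * a ^ (m - k) * (m.choose k : ℝ) := by
        -- Hölder bounds the mixed moment of `A` and `B` by `a^(m-k) b^k`; with the coefficient
        -- bound, each term becomes a term of the binomial expansion of `(a + hyperConst m * v *
        -- b)^m`.
        refine Finset.sum_le_sum fun k hk => ?_
        have hkm : k ≤ m := Nat.lt_succ_iff.1 (Finset.mem_range.1 hk)
        have e : m - k + k = m := Nat.sub_add_cancel hkm
        have h1 := integral_even_pow_mul_even_pow_le hAm hBm (k := m - k) (l := k) ha hb
          (by rwa [e]) (by rwa [e])
        rw [Nat.mul_sub] at h1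
        rw [integral_pow_even_gaussianReal]
        have h2 := choose_mul_moment_le m k hkm
        have h3 := integral_pow_even_nonneg k
        have hv : (0 : ℝ) ≤ v := v.2
        calc ((2 * m).choose (2 * k) : ℝ) * ((v : ℝ) ^ k * (∫ x, x ^ (2 * k) ∂(gaussianReal 0 1)) *
              ∫ ω, A (Y ω) ^ (2 * m - 2 * k) * B (Y ω) ^ (2 * k) ∂P)
            ≤ ((2 * m).choose (2 * k) : ℝ) * ((v : ℝ) ^ k *
              (∫ x, x ^ (2 * k) ∂(gaussianReal 0 1)) * (a ^ (m - k) * b ^ k)) := by gcongr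
          _ = (((2 * m).choose (2 * k) : ℝ) * ∫ x, x ^ (2 * k) ∂(gaussianReal 0 1)) *
              ((v : ℝ) ^ k * (a ^ (m - k) * b ^ k)) := by ring
          _ ≤ (m.choose k * hyperConst m ^ k) * ((v : ℝ) ^ k * (a ^ (m - k) * b ^ k)) := by gcongr
          _ = _ := by rw [mul_pow, mul_pow]; ring
    _ = (a + hyperConst m * v * b) ^ m := by rw [add_comm a, add_pow]

/-- Hypercontractivity for multilinear polynomials in independent centred Gaussian variables. -/
theorem integral_multilinear_gaussian_pow_le {Ω : Type*} [MeasurableSpace Ω] {P : Measure Ω}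
    [IsProbabilityMeasure P] {ι : Type*} [DecidableEq ι] {ξ : ι → Ω → ℝ} {v : ι → NNReal}
    (hm : ∀ k, AEMeasurable (ξ k) P) (hlaw : ∀ k, P.map (ξ k) = gaussianReal 0 (v k))
    (hall : ∀ k, HasAllMoments (ξ k) P) (hind : iIndepFun ξ P) (m : ℕ) (T : Finset ι)
    (c : Finset ι → ℝ) :
    ∫ ω, (∑ S ∈ T.powerset, c S * ∏ k ∈ S, ξ k ω) ^ (2 * m) ∂P
      ≤ (∑ S ∈ T.powerset, hyperConst m ^ S.card * (c S ^ 2 * ∏ k ∈ S, (v k : ℝ))) ^ m := by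
  have hK := one_le_hyperConst m
  induction T using Finset.induction_on generalizing c with
  | empty => simp [pow_mul]
  | insert a T ha ih =>
    have hprod : ∀ S ∈ T.powerset, ∀ ω, ∏ k ∈ insert a S, ξ k ω = ξ a ω * ∏ k ∈ S, ξ k ω :=
      fun S hS ω => Finset.prod_insert fun h => ha (Finset.mem_powerset.1 hS h)
    have hprod' : ∀ S ∈ T.powerset,
        ∏ k ∈ insert a S, (v k : ℝ) = v a * ∏ k ∈ S, (v k : ℝ) :=
      fun S hS => Finset.prod_insert fun h => ha (Finset.mem_powerset.1 hS h)
    have hcard : ∀ S ∈ T.powerset, (insert a S).card = S.card + 1 :=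
      fun S hS => Finset.card_insert_of_notMem fun h => ha (Finset.mem_powerset.1 hS h)
    -- Splitting the sets by whether they contain `a` writes the polynomial as `A + ξ_a B`. Both `A`
    -- and `B` must be measurable functions of the vector `(ξ_k)_{k ∈ T}` for independence from
    -- `ξ_a` to apply.
    obtain ⟨Q, hQ, hQm⟩ : ∃ Q : (Finset ι → ℝ) → (T → ℝ) → ℝ,
        (∀ c ω, Q c (fun k => ξ k.1 ω) = ∑ S ∈ T.powerset, c S * ∏ k ∈ S, ξ k ω) ∧
        ∀ c, Measurable (Q c) := by
      refine ⟨fun c y => ∑ S ∈ T.powerset.attach,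
        c S.1 * ∏ k ∈ S.1.attach, y ⟨k.1, Finset.mem_powerset.1 S.2 k.2⟩, fun c ω => ?_,
        fun c => by fun_prop⟩
      rw [← Finset.sum_attach T.powerset]
      refine Finset.sum_congr rfl fun S _ => ?_
      rw [Finset.prod_attach S.1 (fun k => ξ k ω)]
    have hQall : ∀ c, HasAllMoments (fun ω => Q c (fun k => ξ k.1 ω)) P := by
      intro c
      simp only [hQ]
      exact HasAllMoments.sum _ fun S _ =>
        (HasAllMoments.const _).mul (HasAllMoments.prod _ fun k _ => hall k)
    have hind' : IndepFun (ξ a) (fun ω (k : T) => ξ k.1 ω) P := by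
      have := hind.indepFun_finset₀ {a} T (by simpa using ha) hm
      exact this.comp (φ := fun y : ({a} : Finset ι) → ℝ => y ⟨a, Finset.mem_singleton_self a⟩)
        (ψ := id) (measurable_pi_apply _) measurable_id
    have hnn : ∀ c : Finset ι → ℝ, 0 ≤ ∑ S ∈ T.powerset,
        hyperConst m ^ S.card * (c S ^ 2 * ∏ k ∈ S, (v k : ℝ)) :=
      fun c => Finset.sum_nonneg fun S _ => by positivity
    have hA := ih c
    have hB := ih fun S => c (insert a S)
    simp only [← hQ] at hA hB
    have key := integral_add_gaussian_mul_pow_le (P := P) (Y := fun ω (k : T) => ξ k.1 ω)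
      (A := Q c) (B := Q fun S => c (insert a S)) (hQm c) (hQm _) (v a)
      (hm a) (hlaw a) hind' (hall a) (hQall c) (hQall _) m (hnn c) (hnn _) hA hB
    simp only [hQ] at key
    rw [Finset.sum_powerset_insert ha]
    convert key using 1
    · congr 1 with ω
      rw [Finset.sum_powerset_insert ha, Finset.mul_sum]
      congr 2
      refine Finset.sum_congr rfl fun S hS => ?_
      rw [hprod S hS]; ring
    · congr 2
      rw [Finset.mul_sum]
      refine Finset.sum_congr rfl fun S hS => ?_
      rw [hprod' S hS, hcard S hS, pow_succ]; ring

/-! ### Rectangular increments, boxes and the Brownian covariance. -/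

/-- The rectangular increment of a product of functions of one coordinate. -/
lemma rectIncrement_prod {d : ℕ} (f : Fin d → ℝ → ℝ) (s t : Fin d → ℝ) :
    rectIncrement (fun u => ∏ i, f i (u i)) s t = ∏ i, (f i (t i) - f i (s i)) := by
  simp only [sub_eq_add_neg, Finset.prod_add, rectIncrement, Finset.powerset_univ]
  refine Finset.sum_congr rfl fun A _ => ?_
  have h1 : ∏ i, f i (A.piecewise t s i)
      = (∏ i ∈ A, f i (t i)) * ∏ i ∈ Finset.univ \ A, f i (s i) := by
    rw [← Finset.prod_sdiff (Finset.subset_univ A), mul_comm]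
    congr 1
    · exact Finset.prod_congr rfl fun i hi => by simp [hi]
    · exact Finset.prod_congr rfl fun i hi => by simp [(Finset.mem_sdiff.1 hi).2]
  have h2 : ∏ i ∈ Finset.univ \ A, -f i (s i)
      = (-1) ^ (d - A.card) * ∏ i ∈ Finset.univ \ A, f i (s i) := by
    rw [Finset.prod_neg, Finset.card_sdiff_of_subset (Finset.subset_univ A)]
    simp
  rw [h1, h2]; ring

/-- The indicator function of a half-open box. -/
noncomputable def boxInd {d : ℕ} (a b y : Fin d → ℝ) : ℝ :=
  (halfOpenBox a b).indicator (fun _ => (1 : ℝ)) y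

lemma boxInd_eq_prod {d : ℕ} (a b y : Fin d → ℝ) :
    boxInd a b y = ∏ i, (Set.Ioc (a i) (b i)).indicator (fun _ => (1 : ℝ)) (y i) := by
  classical
  unfold boxInd halfOpenBox
  by_cases h : ∀ i, y i ∈ Set.Ioc (a i) (b i)
  · rw [Set.indicator_of_mem (by simpa [Set.mem_pi] using h)]
    exact (Finset.prod_eq_one fun i _ => Set.indicator_of_mem (h i) _).symm
  · push Not at h
    obtain ⟨i, hi⟩ := h
    rw [Set.indicator_of_notMem (fun hh => hi (Set.mem_univ_pi.1 hh i))]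
    exact (Finset.prod_eq_zero (Finset.mem_univ i) (Set.indicator_of_notMem hi _)).symm

lemma integral_indicator_Ioc_mul (a b a' b' : ℝ) :
    ∫ y, (Set.Ioc a b).indicator (fun _ => (1 : ℝ)) y *
      (Set.Ioc a' b').indicator (fun _ => (1 : ℝ)) y = max 0 (min b b' - max a a') := by
  have h : ∀ y, (Set.Ioc a b).indicator (fun _ => (1 : ℝ)) y *
      (Set.Ioc a' b').indicator (fun _ => (1 : ℝ)) y =
      (Set.Ioc (max a a') (min b b')).indicator (fun _ => (1 : ℝ)) y := by
    intro y
    simp only [← Set.Ioc_inter_Ioc, Set.indicator_apply, Set.mem_inter_iff]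
    split_ifs <;> simp_all
  simp only [h]
  rw [integral_indicator measurableSet_Ioc]
  simp [measureReal_def, ENNReal.toReal_ofReal', max_comm]

/-- The covariance of increments of two-sided Brownian motion is the length of the overlap of the
intervals. The terms `|a|`, `|b|`, … cancel, so only the order of the endpoints matters. -/
lemma brownian_covariance_increment {a b a' b' : ℝ} (h : a ≤ b) (h' : a' ≤ b') :
    ((|b| + |b'| - |b - b'|) / 2 - (|b| + |a'| - |b - a'|) / 2)
      - ((|a| + |b'| - |a - b'|) / 2 - (|a| + |a'| - |a - a'|) / 2)
      = max 0 (min b b' - max a a') := by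
  rcases le_total b b' with h1 | h1 <;> rcases le_total a a' with h2 | h2 <;>
  rcases le_total b a' with h3 | h3 <;> rcases le_total a b' with h4 | h4 <;>
  simp only [h1, h2, min_eq_left, min_eq_right, max_eq_left, max_eq_right] <;>
  first
  | rw [abs_of_nonneg (sub_nonneg.2 h1)]
  | rw [abs_of_nonpos (sub_nonpos.2 h1)]
  all_goals first
  | rw [abs_of_nonneg (sub_nonneg.2 h3)]
  | rw [abs_of_nonpos (sub_nonpos.2 h3)]
  all_goals first
  | rw [abs_of_nonneg (sub_nonneg.2 h4)]
  | rw [abs_of_nonpos (sub_nonpos.2 h4)]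
  all_goals first
  | rw [abs_of_nonneg (sub_nonneg.2 h2)]
  | rw [abs_of_nonpos (sub_nonpos.2 h2)]
  all_goals first
  | (rw [max_eq_right (by linarith)]; linarith)
  | (rw [max_eq_left (by linarith)]; linarith)

/-- Once the product is an iterated increment of `X u * Y w`, an expectation passes inside and acts
on the covariance alone. -/
lemma rectIncrement_mul_rectIncrement {d : ℕ} (X Y : (Fin d → ℝ) → ℝ) (a b a' b' : Fin d → ℝ) :
    rectIncrement X a b * rectIncrement Y a' b' =
      rectIncrement (fun u => rectIncrement (fun w => X u * Y w) a' b') a b := by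
  simp only [rectIncrement]
  rw [Finset.sum_mul_sum]
  refine Finset.sum_congr rfl fun A _ => ?_
  rw [Finset.mul_sum]
  exact Finset.sum_congr rfl fun B _ => by ring

/-! ### White noise on boxes. -/

section Sheet

variable {Ω : Type*} [MeasurableSpace Ω] {P : Measure Ω} {d : ℕ} {W : (Fin d → ℝ) → Ω → ℝ}

namespace IsBrownianSheet

lemma memLp (hW : IsBrownianSheet W P) (t : Fin d → ℝ) : HasAllMoments (W t) P :=
  fun _ hp => (hW.gaussian.hasGaussianLaw_eval t).memLp hp

lemma rectIncrement_memLp (hW : IsBrownianSheet W P) (a b : Fin d → ℝ) :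
    HasAllMoments (fun ω => rectIncrement (fun u => W u ω) a b) P := by
  intro p hp
  unfold rectIncrement
  exact memLp_finsetSum _ fun A _ => (hW.memLp _ p hp).const_mul _

lemma integral_rectIncrement [IsProbabilityMeasure P] (hW : IsBrownianSheet W P)
    (a b : Fin d → ℝ) : ∫ ω, rectIncrement (fun u => W u ω) a b ∂P = 0 := by
  unfold rectIncrement
  rw [integral_finsetSum _ fun A _ => ((hW.memLp _).integrable.const_mul _)]
  refine Finset.sum_eq_zero fun A _ => ?_
  rw [integral_const_mul, hW.centered, mul_zero]

/-- The covariance is a product over coordinates, so taking increments in both arguments leaves a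
product of one-dimensional overlap lengths, that is, the volume of the intersection. -/
lemma integral_rectIncrement_mul [IsProbabilityMeasure P] (hW : IsBrownianSheet W P)
    {a b a' b' : Fin d → ℝ} (h : ∀ i, a i ≤ b i) (h' : ∀ i, a' i ≤ b' i) :
    ∫ ω, rectIncrement (fun u => W u ω) a b * rectIncrement (fun u => W u ω) a' b' ∂P
      = ∫ y, boxInd a b y * boxInd a' b' y := by
  have hR : ∫ y, boxInd a b y * boxInd a' b' y
      = ∏ i, max 0 (min (b i) (b' i) - max (a i) (a' i)) := by
    simp only [boxInd_eq_prod, ← Finset.prod_mul_distrib]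
    rw [integral_fintype_prod_volume_eq_prod (fun i x =>
      (Set.Ioc (a i) (b i)).indicator (fun _ => (1 : ℝ)) x *
      (Set.Ioc (a' i) (b' i)).indicator (fun _ => (1 : ℝ)) x)]
    exact Finset.prod_congr rfl fun i _ => integral_indicator_Ioc_mul _ _ _ _
  have hint : ∀ s t, Integrable (fun ω => W s ω * W t ω) P :=
    fun s t => ((hW.memLp s).mul (hW.memLp t)).integrable
  have hL : ∫ ω, rectIncrement (fun u => W u ω) a b * rectIncrement (fun u => W u ω) a' b' ∂P
      = rectIncrement (fun u => rectIncrement (fun w => ∫ ω, W u ω * W w ω ∂P) a' b') a b := by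
    simp only [rectIncrement_mul_rectIncrement]
    unfold rectIncrement
    rw [integral_finsetSum]
    · refine Finset.sum_congr rfl fun A _ => ?_
      rw [integral_const_mul, integral_finsetSum]
      · simp only [integral_const_mul]
      · exact fun B _ => (hint _ _).const_mul _
    · exact fun A _ => (integrable_finsetSum _ fun B _ => (hint _ _).const_mul _).const_mul _
  rw [hL, hR]
  simp only [hW.covariance]
  have h1 : ∀ u : Fin d → ℝ,
      rectIncrement (fun w => ∏ i, (|u i| + |w i| - |u i - w i|) / 2) a' b'
      = ∏ i, ((|u i| + |b' i| - |u i - b' i|) / 2 - (|u i| + |a' i| - |u i - a' i|) / 2) :=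
    fun u => rectIncrement_prod (fun i x => (|u i| + |x| - |u i - x|) / 2) a' b'
  simp only [h1]
  rw [rectIncrement_prod (fun i x =>
    ((|x| + |b' i| - |x - b' i|) / 2 - (|x| + |a' i| - |x - a' i|) / 2)) a b]
  exact Finset.prod_congr rfl fun i _ => brownian_covariance_increment (h i) (h' i)

/-- Finitely many increments are a linear image of finitely many values of `W`. Joint Gaussianity is
what makes uncorrelated increments independent. -/
lemma hasGaussianLaw_rectIncrement (hW : IsBrownianSheet W P) {ι : Type*} [Fintype ι]
    (a b : ι → Fin d → ℝ) :
    HasGaussianLaw (fun ω k => rectIncrement (fun u => W u ω) (a k) (b k)) P := by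
  classical
  let I : Finset (Fin d → ℝ) := Finset.univ.biUnion fun k : ι =>
    Finset.univ.image fun A : Finset (Fin d) => A.piecewise (b k) (a k)
  have hI : ∀ k (A : Finset (Fin d)), A.piecewise (b k) (a k) ∈ I := fun k A =>
    Finset.mem_biUnion.2 ⟨k, Finset.mem_univ k, Finset.mem_image_of_mem _ (Finset.mem_univ A)⟩
  let L : (I → ℝ) →L[ℝ] ι → ℝ := LinearMap.toContinuousLinearMap
    { toFun x k := ∑ A : Finset (Fin d), (-1 : ℝ) ^ (d - A.card) * x ⟨_, hI k A⟩
      map_add' x y := by ext; simp [mul_add, Finset.sum_add_distrib]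
      map_smul' c x := by
        ext; simp only [Pi.smul_apply, smul_eq_mul, RingHom.id_apply, Finset.mul_sum]
        exact Finset.sum_congr rfl fun _ _ => by ring }
  exact (hW.gaussian.hasGaussianLaw I).map L

end IsBrownianSheet

lemma measurable_boxInd (a b : Fin d → ℝ) : Measurable (boxInd a b) := by
  refine measurable_const.indicator ?_
  exact MeasurableSet.univ_pi fun i => measurableSet_Ioc

lemma integrable_boxInd_mul (a b a' b' : Fin d → ℝ) :
    Integrable (fun y => boxInd a b y * boxInd a' b' y) := by
  simp only [boxInd_eq_prod, ← Finset.prod_mul_distrib]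
  refine Integrable.fintype_prod (f := fun i x =>
      (Set.Ioc (a i) (b i)).indicator (fun _ => (1 : ℝ)) x *
      (Set.Ioc (a' i) (b' i)).indicator (fun _ => (1 : ℝ)) x) fun i => ?_
  simp only [← Set.inter_indicator_mul]
  rw [integrable_indicator_iff (measurableSet_Ioc.inter measurableSet_Ioc)]
  refine IntegrableOn.mono_set (t := Set.Ioc (a i) (b i)) ?_ Set.inter_subset_left
  simp

/-- The white noise isometry for linear combinations of boxes. -/
lemma IsBrownianSheet.integral_sum_rectIncrement_sq [IsProbabilityMeasure P]
    (hW : IsBrownianSheet W P) {ι : Type*} (T : Finset ι) (c : ι → ℝ) (a b : ι → Fin d → ℝ)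
    (h : ∀ k i, a k i ≤ b k i) :
    ∫ ω, (∑ k ∈ T, c k * rectIncrement (fun u => W u ω) (a k) (b k)) ^ 2 ∂P
      = ∫ y, (∑ k ∈ T, c k * boxInd (a k) (b k) y) ^ 2 := by
  simp only [pow_two, Finset.sum_mul_sum]
  have e : ∀ k l, ∀ x y : ℝ, c k * x * (c l * y) = c k * c l * (x * y) := fun _ _ _ _ => by ring
  simp only [e]
  have hi : ∀ k l, Integrable (fun ω => rectIncrement (fun u => W u ω) (a k) (b k) *
      rectIncrement (fun u => W u ω) (a l) (b l)) P := fun k l =>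
    ((hW.rectIncrement_memLp _ _).mul (hW.rectIncrement_memLp _ _)).integrable
  rw [integral_finsetSum _ fun k _ => integrable_finsetSum _ fun l _ => (hi k l).const_mul _,
    integral_finsetSum _ fun k _ => integrable_finsetSum _ fun l _ =>
      (integrable_boxInd_mul _ _ _ _).const_mul _]
  refine Finset.sum_congr rfl fun k _ => ?_
  rw [integral_finsetSum _ fun l _ => (hi k l).const_mul _,
    integral_finsetSum _ fun l _ => (integrable_boxInd_mul _ _ _ _).const_mul _]
  refine Finset.sum_congr rfl fun l _ => ?_
  rw [integral_const_mul, integral_const_mul, hW.integral_rectIncrement_mul (h k) (h l)]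

lemma IsBrownianSheet.iIndepFun_rectIncrement [IsProbabilityMeasure P]
    (hW : IsBrownianSheet W P) {ι : Type*} [Fintype ι] (a b : ι → Fin d → ℝ)
    (h : ∀ k i, a k i ≤ b k i)
    (hd : ∀ k l, k ≠ l → ∀ y, boxInd (a k) (b k) y * boxInd (a l) (b l) y = 0) :
    iIndepFun (fun k ω => rectIncrement (fun u => W u ω) (a k) (b k)) P := by
  refine (hW.hasGaussianLaw_rectIncrement a b).iIndepFun_of_covariance_eq_zero fun k l hkl => ?_
  rw [covariance_eq_sub (hW.rectIncrement_memLp _ _ 2 (by simp))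
    (hW.rectIncrement_memLp _ _ 2 (by simp)), hW.integral_rectIncrement, zero_mul, sub_zero]
  simp only [Pi.mul_apply]
  rw [hW.integral_rectIncrement_mul (h k) (h l)]
  simp [hd k l hkl]

lemma IsBrownianSheet.map_rectIncrement [IsProbabilityMeasure P]
    (hW : IsBrownianSheet W P) (a b : Fin d → ℝ) (h : ∀ i, a i ≤ b i) :
    P.map (fun ω => rectIncrement (fun u => W u ω) a b)
      = gaussianReal 0 (∫ y, boxInd a b y * boxInd a b y).toNNReal := by
  have hg := (hW.hasGaussianLaw_rectIncrement (ι := Unit) (fun _ => a) (fun _ => b)).eval ()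
  rw [hg.map_eq_gaussianReal, hW.integral_rectIncrement, variance_of_integral_eq_zero
    hg.aemeasurable (hW.integral_rectIncrement _ _), ← hW.integral_rectIncrement_mul h h]
  simp only [pow_two]

end Sheet

/-! ### Refinement of boxes to a common grid. -/

lemma exists_strictMono_nat_of_finset (G : Finset ℝ) :
    ∃ g : ℕ → ℝ, StrictMono g ∧ ∀ x ∈ G, ∃ k, g k = x := by
  obtain ⟨B, hB⟩ : ∃ B : ℝ, ∀ x ∈ G, x ≤ B := by
    obtain ⟨B, hB⟩ := G.finite_toSet.bddAbove
    exact ⟨B, fun x hx => hB hx⟩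
  let e := G.orderEmbOfFin rfl
  -- The sequence continues past the finite set above its upper bound `B`, so that it stays strictly
  -- increasing and no cell of the grid is exceptional.
  refine ⟨fun k => if h : k < G.card then e ⟨k, h⟩ else B + 1 + k, ?_, ?_⟩
  · refine strictMono_nat_of_lt_succ fun n => ?_
    by_cases h1 : n + 1 < G.card
    · have h0 : n < G.card := by omega
      simp only [h0, h1, dif_pos]
      exact e.strictMono (by simp)
    · simp only [h1, dif_neg, not_false_eq_true]
      by_cases h0 : n < G.card
      · simp only [h0, dif_pos]
        have := hB (e ⟨n, h0⟩) (G.orderEmbOfFin_mem rfl _)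
        push_cast
        have hn : (0 : ℝ) ≤ n := n.cast_nonneg
        linarith
      · simp only [h0, dif_neg, not_false_eq_true]
        push_cast; linarith
  · intro x hx
    have : x ∈ Set.range e := by rw [Finset.range_orderEmbOfFin]; exact hx
    obtain ⟨k, hk⟩ := this
    exact ⟨k, by simpa using hk⟩

/-- A grid interval contains a cell entirely or misses it, and the upper endpoint, which belongs to
the half-open cell, decides which. -/
lemma indicator_Ioc_grid {g : ℕ → ℝ} (hg : StrictMono g) {N p r : ℕ} (hr : r ≤ N) (y : ℝ) :
    (Set.Ioc (g p) (g r)).indicator (fun _ => (1 : ℝ)) y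
      = ∑ k : Fin N, (Set.Ioc (g p) (g r)).indicator (fun _ => (1 : ℝ)) (g (k + 1)) *
          (Set.Ioc (g k) (g (k + 1))).indicator (fun _ => (1 : ℝ)) y := by
  by_cases hy : ∃ k : Fin N, y ∈ Set.Ioc (g k) (g (k + 1))
  · obtain ⟨k, hk⟩ := hy
    rw [Finset.sum_eq_single k]
    · rw [Set.indicator_of_mem hk, mul_one]
      have : y ∈ Set.Ioc (g p) (g r) ↔ g (k + 1) ∈ Set.Ioc (g p) (g r) := by
        simp only [Set.mem_Ioc, hg.lt_iff_lt, hg.le_iff_le]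
        constructor
        · rintro ⟨h1, h2⟩
          exact ⟨hg.lt_iff_lt.1 (h1.trans_le hk.2), hg.lt_iff_lt.1 (hk.1.trans_le h2)⟩
        · rintro ⟨h1, h2⟩
          exact ⟨(hg.monotone (Nat.lt_succ_iff.1 h1)).trans_lt hk.1, hk.2.trans (hg.monotone h2)⟩
      by_cases h : y ∈ Set.Ioc (g p) (g r)
      · rw [Set.indicator_of_mem h, Set.indicator_of_mem (this.1 h)]
      · rw [Set.indicator_of_notMem h, Set.indicator_of_notMem (fun h' => h (this.2 h'))]
    · intro l _ hl
      rw [Set.indicator_of_notMem (s := Set.Ioc (g l) (g (l + 1))), mul_zero]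
      rintro ⟨h1, h2⟩
      have a1 : (k : ℕ) < l + 1 := hg.lt_iff_lt.1 (hk.1.trans_le h2)
      have a2 : (l : ℕ) < k + 1 := hg.lt_iff_lt.1 (h1.trans_le hk.2)
      exact hl (Fin.ext (by omega))
    · simp
  · rw [Set.indicator_of_notMem, Finset.sum_eq_zero]
    · intro k _
      rw [Set.indicator_of_notMem (s := Set.Ioc (g k) (g (k + 1))) (fun h => hy ⟨k, h⟩), mul_zero]
    · rintro ⟨h1, h2⟩
      have hex : ∃ k, y ≤ g k := ⟨r, h2⟩
      classical
      have hf := Nat.find_spec hex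
      have hle : Nat.find hex ≤ r := Nat.find_min' hex h2
      have hpos : p < Nat.find hex := hg.lt_iff_lt.1 (h1.trans_le hf)
      refine hy ⟨⟨Nat.find hex - 1, by omega⟩, ?_⟩
      have hlt := Nat.find_min hex (m := Nat.find hex - 1) (by omega)
      simp only [Set.mem_Ioc, Nat.sub_add_cancel (by omega : 1 ≤ Nat.find hex)]
      exact ⟨not_le.1 hlt, hf⟩

/-- The lower corner of a cell of the grid generated by `g`. -/
def gridLower {d N : ℕ} (g : ℕ → ℝ) (k : Fin d → Fin N) : Fin d → ℝ := fun i => g (k i)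

/-- The upper corner of a cell of the grid generated by `g`. -/
def gridUpper {d N : ℕ} (g : ℕ → ℝ) (k : Fin d → Fin N) : Fin d → ℝ := fun i => g (k i + 1)

lemma gridLower_le_gridUpper {d N : ℕ} {g : ℕ → ℝ} (hg : StrictMono g) (k : Fin d → Fin N)
    (i : Fin d) : gridLower g k i ≤ gridUpper g k i :=
  hg.monotone (Nat.le_succ _)

lemma boxInd_grid {d N : ℕ} {g : ℕ → ℝ} (hg : StrictMono g) {a b : Fin d → ℝ}
    (ha : ∀ i, ∃ p, g p = a i) (hb : ∀ i, ∃ r ≤ N, g r = b i) (y : Fin d → ℝ) :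
    boxInd a b y = ∑ k : Fin d → Fin N, boxInd a b (gridUpper g k) *
      boxInd (gridLower g k) (gridUpper g k) y := by
  simp only [boxInd_eq_prod, ← Finset.prod_mul_distrib]
  have h : ∀ i, (Set.Ioc (a i) (b i)).indicator (fun _ => (1 : ℝ)) (y i)
      = ∑ k : Fin N, (Set.Ioc (a i) (b i)).indicator (fun _ => (1 : ℝ)) (g (k + 1)) *
          (Set.Ioc (g k) (g (k + 1))).indicator (fun _ => (1 : ℝ)) (y i) := by
    intro i
    obtain ⟨p, hp⟩ := ha i
    obtain ⟨r, hr, hr'⟩ := hb i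
    rw [← hp, ← hr']
    exact indicator_Ioc_grid hg hr _
  simp only [h]
  rw [Finset.prod_univ_sum, Fintype.piFinset_univ]
  simp only [gridLower, gridUpper]

lemma boxInd_grid_mul_of_ne {d N : ℕ} {g : ℕ → ℝ} (hg : StrictMono g) {k l : Fin d → Fin N}
    (hkl : k ≠ l) (y : Fin d → ℝ) :
    boxInd (gridLower g k) (gridUpper g k) y * boxInd (gridLower g l) (gridUpper g l) y = 0 := by
  obtain ⟨i, hi⟩ := Function.ne_iff.1 hkl
  simp only [boxInd_eq_prod, ← Finset.prod_mul_distrib]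
  refine Finset.prod_eq_zero (Finset.mem_univ i) ?_
  by_contra h
  obtain ⟨h1, h2⟩ := mul_ne_zero_iff.1 h
  have m1 := Set.mem_of_indicator_ne_zero h1
  have m2 := Set.mem_of_indicator_ne_zero h2
  simp only [gridLower, gridUpper, Set.mem_Ioc] at m1 m2
  have a1 : (k i : ℕ) < l i + 1 := hg.lt_iff_lt.1 (m1.1.trans_le m2.2)
  have a2 : (l i : ℕ) < k i + 1 := hg.lt_iff_lt.1 (m2.1.trans_le m1.2)
  exact hi (Fin.ext (by omega))

namespace ElementaryIntegrand

variable {d q : ℕ}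

lemma eval_eq (F : ElementaryIntegrand d q) (y : Fin q → Fin d → ℝ) :
    F.eval y = ∑ κ : Fin q → Fin F.n, F.coeff κ *
      ∏ j, boxInd (F.lower (κ j)) (F.upper (κ j)) (y j) := rfl

/-- After refinement the coefficients are values of `eval` at corners of cells; this shows that they
still vanish on the diagonals. -/
lemma eval_eq_zero_of_not_injective (F : ElementaryIntegrand d q) {y : Fin q → Fin d → ℝ}
    (hy : ¬ Function.Injective y) : F.eval y = 0 := by
  rw [eval_eq]
  refine Finset.sum_eq_zero fun κ _ => ?_
  by_contra h
  obtain ⟨h1, h2⟩ := mul_ne_zero_iff.1 h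
  have hκ : Function.Injective κ := by
    by_contra hκ
    exact h1 (F.coeff_diagonal κ hκ)
  have hmem : ∀ j, y j ∈ halfOpenBox (F.lower (κ j)) (F.upper (κ j)) := fun j =>
    Set.mem_of_indicator_ne_zero (Finset.prod_ne_zero_iff.1 h2 j (Finset.mem_univ j))
  refine hy fun j l hjl => ?_
  by_contra hne
  refine Set.disjoint_left.1 (F.disjoint (κ j) (κ l) (fun e => hne (hκ e))) (hmem j) ?_
  rw [hjl]; exact hmem l

/-- One change of basis serves both the integrand (with `X`, `ξ` indicators) and its integral (with
`X`, `ξ` noise increments), so both acquire the same refined coefficients. -/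
lemma sum_coeff_mul_prod_eq (F : ElementaryIntegrand d q) {ι : Type*} [Fintype ι]
    (corner : ι → Fin d → ℝ) (X : Fin q → Fin F.n → ℝ) (ξ : Fin q → ι → ℝ)
    (h : ∀ j k, X j k = ∑ p, boxInd (F.lower k) (F.upper k) (corner p) * ξ j p) :
    ∑ κ : Fin q → Fin F.n, F.coeff κ * ∏ j, X j (κ j)
      = ∑ ψ : Fin q → ι, F.eval (fun j => corner (ψ j)) * ∏ j, ξ j (ψ j) := by
  classical
  simp only [h, eval_eq, Finset.prod_univ_sum, Fintype.piFinset_univ, Finset.mul_sum,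
    Finset.sum_mul, Finset.prod_mul_distrib]
  rw [Finset.sum_comm]
  exact Finset.sum_congr rfl fun ψ _ => Finset.sum_congr rfl fun κ _ => by ring

end ElementaryIntegrand

/-! ### Comparison of moments on the chaos of order `q`. -/

section OffDiagonal

variable {Ω : Type*} [MeasurableSpace Ω] {P : Measure Ω} {d q : ℕ} {W : (Fin d → ℝ) → Ω → ℝ}

/-- Tensor products of disjoint boxes are themselves disjoint, so all cross terms vanish pointwise.
-/
lemma integral_sum_prod_boxInd_sq {ι : Type*} [Fintype ι] (a b : ι → Fin d → ℝ)
    (hd : ∀ k l, k ≠ l → ∀ y, boxInd (a k) (b k) y * boxInd (a l) (b l) y = 0)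
    (c : (Fin q → ι) → ℝ) :
    Integrable (fun y : Fin q → Fin d → ℝ =>
      (∑ ψ, c ψ * ∏ j, boxInd (a (ψ j)) (b (ψ j)) (y j)) ^ 2) ∧
    ∫ y : Fin q → Fin d → ℝ, (∑ ψ, c ψ * ∏ j, boxInd (a (ψ j)) (b (ψ j)) (y j)) ^ 2
      = ∑ ψ, c ψ ^ 2 * ∏ j, ∫ y, boxInd (a (ψ j)) (b (ψ j)) y * boxInd (a (ψ j)) (b (ψ j)) y := by
  classical
  have h : ∀ y : Fin q → Fin d → ℝ, (∑ ψ, c ψ * ∏ j, boxInd (a (ψ j)) (b (ψ j)) (y j)) ^ 2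
      = ∑ ψ, c ψ ^ 2 * ∏ j, (boxInd (a (ψ j)) (b (ψ j)) (y j) *
          boxInd (a (ψ j)) (b (ψ j)) (y j)) := by
    intro y
    rw [pow_two, Finset.sum_mul_sum]
    refine Finset.sum_congr rfl fun ψ _ => ?_
    rw [Finset.sum_eq_single ψ]
    · rw [Finset.prod_mul_distrib]; ring
    · intro φ _ hφ
      obtain ⟨j, hj⟩ := Function.ne_iff.1 hφ
      have h0 : (∏ j, boxInd (a (ψ j)) (b (ψ j)) (y j)) * ∏ j, boxInd (a (φ j)) (b (φ j)) (y j)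
          = 0 := by
        rw [← Finset.prod_mul_distrib]
        exact Finset.prod_eq_zero (Finset.mem_univ j) (hd _ _ hj.symm _)
      calc _ = c ψ * c φ * ((∏ j, boxInd (a (ψ j)) (b (ψ j)) (y j)) *
            ∏ j, boxInd (a (φ j)) (b (φ j)) (y j)) := by ring
        _ = 0 := by rw [h0, mul_zero]
    · simp
  have hi : ∀ ψ : Fin q → ι, Integrable (fun y : Fin q → Fin d → ℝ =>
      ∏ j, (boxInd (a (ψ j)) (b (ψ j)) (y j) * boxInd (a (ψ j)) (b (ψ j)) (y j))) := fun ψ =>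
    Integrable.fintype_prod (f := fun j x => boxInd (a (ψ j)) (b (ψ j)) x *
      boxInd (a (ψ j)) (b (ψ j)) x) fun j => integrable_boxInd_mul _ _ _ _
  simp only [h]
  refine ⟨integrable_finsetSum _ fun ψ _ => (hi ψ).const_mul _, ?_⟩
  rw [integral_finsetSum _ fun ψ _ => (hi ψ).const_mul _]
  refine Finset.sum_congr rfl fun ψ _ => ?_
  rw [integral_const_mul, integral_fintype_prod_volume_eq_prod (fun j x =>
    boxInd (a (ψ j)) (b (ψ j)) x * boxInd (a (ψ j)) (b (ψ j)) x)]

/-- The constant in the comparison of moments of order `2m` on the chaos of order `q`. -/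
noncomputable def chaosConst (q m : ℕ) : ℝ := hyperConst m ^ q * (q : ℝ) ^ q

lemma chaosConst_nonneg (q m : ℕ) : 0 ≤ chaosConst q m := by
  have := one_le_hyperConst m
  unfold chaosConst; positivity

/-- Comparison of moments for off-diagonal multilinear forms in the noise of disjoint boxes. -/
lemma IsBrownianSheet.integral_offDiagonal_pow_le [IsProbabilityMeasure P]
    (hW : IsBrownianSheet W P) {ι : Type*} [Fintype ι] (a b : ι → Fin d → ℝ)
    (h : ∀ k i, a k i ≤ b k i)
    (hd : ∀ k l, k ≠ l → ∀ y, boxInd (a k) (b k) y * boxInd (a l) (b l) y = 0)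
    (c : (Fin q → ι) → ℝ) (hc : ∀ ψ, ¬ Function.Injective ψ → c ψ = 0) (m : ℕ) :
    ∫ ω, (∑ ψ, c ψ * ∏ j, rectIncrement (fun u => W u ω) (a (ψ j)) (b (ψ j))) ^ (2 * m) ∂P
      ≤ (chaosConst q m * ∫ y : Fin q → Fin d → ℝ,
          (∑ ψ, c ψ * ∏ j, boxInd (a (ψ j)) (b (ψ j)) (y j)) ^ 2) ^ m := by
  classical
  have hK := one_le_hyperConst m
  rw [(integral_sum_prod_boxInd_sq a b hd c).2]
  set ξ : ι → Ω → ℝ := fun k ω => rectIncrement (fun u => W u ω) (a k) (b k) with hξ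
  set v : ι → ℝ := fun k => ∫ y, boxInd (a k) (b k) y * boxInd (a k) (b k) y with hv
  have hv0 : ∀ k, 0 ≤ v k := fun k => integral_nonneg fun y => mul_self_nonneg _
  have hvr : ∀ k, ((v k).toNNReal : ℝ) = v k := fun k => Real.coe_toNNReal _ (hv0 k)
  -- Only injective `ψ` contribute, and their monomials depend only on the image. The coefficients
  -- are not assumed symmetric: those with the same image are added up, and Cauchy–Schwarz over at
  -- most `q^q` of them is the source of that factor in `chaosConst`.
  let C : Finset ι → ℝ := fun S => ∑ ψ with Finset.image ψ Finset.univ = S, c ψ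
  have hprod : ∀ (ψ : Fin q → ι) (x : ι → ℝ) (e : ℝ), (¬ Function.Injective ψ → e = 0) →
      e * ∏ j, x (ψ j) = e * ∏ k ∈ Finset.image ψ Finset.univ, x k := by
    intro ψ x e he
    by_cases hψ : Function.Injective ψ
    · rw [Finset.prod_image (fun i _ j _ hij => hψ hij)]
    · rw [he hψ, zero_mul, zero_mul]
  have hsum : ∀ ω, ∑ ψ, c ψ * ∏ j, ξ (ψ j) ω
      = ∑ S ∈ (Finset.univ : Finset ι).powerset, C S * ∏ k ∈ S, ξ k ω := by
    intro ω
    rw [← Finset.sum_fiberwise_of_maps_to (s := Finset.univ)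
      (t := (Finset.univ : Finset ι).powerset) (g := fun ψ : Fin q → ι =>
        Finset.image ψ Finset.univ) (fun ψ _ => by simp)]
    refine Finset.sum_congr rfl fun S _ => ?_
    simp only [C, Finset.sum_mul]
    refine Finset.sum_congr rfl fun ψ hψ => ?_
    rw [hprod ψ (fun k => ξ k ω) _ (hc ψ), (Finset.mem_filter.1 hψ).2]
  change ∫ ω, (∑ ψ, c ψ * ∏ j, ξ (ψ j) ω) ^ (2 * m) ∂P ≤ _
  simp only [hsum]
  refine (integral_multilinear_gaussian_pow_le (v := fun k => (v k).toNNReal)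
    (fun k => (hW.rectIncrement_memLp _ _).integrable.aemeasurable)
    (fun k => hW.map_rectIncrement _ _ (h k)) (fun k => hW.rectIncrement_memLp _ _)
    (hW.iIndepFun_rectIncrement a b h hd) m Finset.univ C).trans ?_
  refine pow_le_pow_left₀ (Finset.sum_nonneg fun S _ => by positivity) ?_ m
  simp only [hvr]
  rw [← Finset.sum_fiberwise_of_maps_to (s := Finset.univ)
      (t := (Finset.univ : Finset ι).powerset) (g := fun ψ : Fin q → ι =>
        Finset.image ψ Finset.univ) (fun ψ _ => by simp), Finset.mul_sum]
  refine Finset.sum_le_sum fun S _ => ?_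
  have hvS : 0 ≤ ∏ k ∈ S, v k := Finset.prod_nonneg fun k _ => hv0 k
  have hR : ∑ ψ : Fin q → ι with Finset.image ψ Finset.univ = S, c ψ ^ 2 * ∏ j, v (ψ j)
      = (∑ ψ : Fin q → ι with Finset.image ψ Finset.univ = S, c ψ ^ 2) * ∏ k ∈ S, v k := by
    rw [Finset.sum_mul]
    refine Finset.sum_congr rfl fun ψ hψ => ?_
    rw [hprod ψ v _ (fun hh => by simp [hc ψ hh]), (Finset.mem_filter.1 hψ).2]
  change _ ≤ chaosConst q m *
    ∑ ψ : Fin q → ι with Finset.image ψ Finset.univ = S, c ψ ^ 2 * ∏ j, v (ψ j)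
  rw [hR]
  rcases Nat.lt_or_ge q S.card with hS | hS
  · have : C S = 0 := by
      refine Finset.sum_eq_zero fun ψ hψ => ?_
      have := (Finset.mem_filter.1 hψ).2
      have hle : S.card ≤ q := by rw [← this]; exact Finset.card_image_le.trans (by simp)
      omega
    rw [this]
    have := chaosConst_nonneg q m
    have : 0 ≤ ∑ ψ : Fin q → ι with Finset.image ψ Finset.univ = S, c ψ ^ 2 :=
      Finset.sum_nonneg fun _ _ => sq_nonneg _
    simp only [ne_eq, OfNat.ofNat_ne_zero, not_false_eq_true, zero_pow, zero_mul, mul_zero]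
    positivity
  · have hcard : ((Finset.univ.filter fun ψ : Fin q → ι =>
        Finset.image ψ Finset.univ = S).card : ℝ) ≤ (q : ℝ) ^ q := by
      have hsub : (Finset.univ.filter fun ψ : Fin q → ι => Finset.image ψ Finset.univ = S)
          ⊆ Fintype.piFinset fun _ => S := by
        intro ψ hψ
        rw [Fintype.mem_piFinset]
        intro j
        rw [← (Finset.mem_filter.1 hψ).2]
        exact Finset.mem_image_of_mem _ (Finset.mem_univ j)
      have := Finset.card_le_card hsub
      rw [Fintype.card_piFinset_const] at this
      exact_mod_cast this.trans (Nat.pow_le_pow_left hS q)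
    have hC : C S ^ 2 ≤ (q : ℝ) ^ q *
        ∑ ψ : Fin q → ι with Finset.image ψ Finset.univ = S, c ψ ^ 2 :=
      sq_sum_le_card_mul_sum_sq.trans
        (mul_le_mul_of_nonneg_right hcard (Finset.sum_nonneg fun _ _ => sq_nonneg _))
    have hKp : hyperConst m ^ S.card ≤ hyperConst m ^ q := pow_le_pow_right₀ hK hS
    calc hyperConst m ^ S.card * (C S ^ 2 * ∏ k ∈ S, v k)
        ≤ hyperConst m ^ q * (((q : ℝ) ^ q *
        ∑ ψ : Fin q → ι with Finset.image ψ Finset.univ = S, c ψ ^ 2) * ∏ k ∈ S, v k) := by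
          gcongr
      _ = _ := by unfold chaosConst; ring

end OffDiagonal

lemma tendsto_eLpNorm_sum_sub {β V : Type*} [MeasurableSpace β] [Fintype V] {μ : Measure β}
    (α : V → ℝ) {A : ℕ → V → β → ℝ} {B : V → β → ℝ} (hA : ∀ n v, AEStronglyMeasurable (A n v) μ)
    (hB : ∀ v, AEStronglyMeasurable (B v) μ)
    (hAB : ∀ v, Tendsto (fun n => eLpNorm (fun x => A n v x - B v x) 2 μ) atTop (𝓝 0)) :
    Tendsto (fun n => eLpNorm ((fun x => ∑ v, α v * A n v x) - fun x => ∑ v, α v * B v x) 2 μ)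
      atTop (𝓝 0) := by
  have hle : ∀ n, eLpNorm ((fun x => ∑ v, α v * A n v x) - fun x => ∑ v, α v * B v x) 2 μ
      ≤ ∑ v, ‖α v‖ₑ * eLpNorm (fun x => A n v x - B v x) 2 μ := by
    intro n
    have e : ((fun x => ∑ v, α v * A n v x) - fun x => ∑ v, α v * B v x)
        = ∑ v, α v • fun x => A n v x - B v x := by
      ext x
      simp [mul_sub, Finset.sum_apply]
    rw [e]
    refine (eLpNorm_sum_le (fun v _ => ((hA n v).sub (hB v)).const_smul _) (by simp)).trans ?_
    exact Finset.sum_le_sum fun v _ => (eLpNorm_const_smul _ _ _ _).le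
  refine tendsto_of_tendsto_of_tendsto_of_le_of_le tendsto_const_nhds ?_
    (fun _ => zero_le) hle
  have : Tendsto (fun n => ∑ v, ‖α v‖ₑ * eLpNorm (fun x => A n v x - B v x) 2 μ) atTop
      (𝓝 (∑ v, ‖α v‖ₑ * 0)) :=
    tendsto_finsetSum _ fun v _ => ENNReal.Tendsto.const_mul (hAB v) (Or.inr (by simp))
  simpa using this

section Chaos

variable {Ω : Type*} [MeasurableSpace Ω] {P : Measure Ω} {d q : ℕ} {W : (Fin d → ℝ) → Ω → ℝ}

/-- White noise is additive: a box that is a disjoint union of grid cells. -/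
lemma IsBrownianSheet.rectIncrement_ae_eq_sum [IsProbabilityMeasure P]
    (hW : IsBrownianSheet W P) {ι : Type*} [Fintype ι] (a b : ι → Fin d → ℝ)
    (h : ∀ k i, a k i ≤ b k i) {a' b' : Fin d → ℝ} (h' : ∀ i, a' i ≤ b' i) (e : ι → ℝ)
    (he : ∀ y, boxInd a' b' y = ∑ k, e k * boxInd (a k) (b k) y) :
    ∀ᵐ ω ∂P, rectIncrement (fun u => W u ω) a' b'
      = ∑ k, e k * rectIncrement (fun u => W u ω) (a k) (b k) := by
  -- The isometry is applied to the box (index `none`) minus its decomposition. The corresponding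
  -- function is identically zero, so the difference of increments has zero second moment.
  have key := hW.integral_sum_rectIncrement_sq (Finset.univ : Finset (Option ι))
    (fun o => o.elim 1 fun k => -e k) (fun o => o.elim a' a) (fun o => o.elim b' b)
    (fun o i => by cases o with
      | none => exact h' i
      | some k => exact h k i)
  simp only [Fintype.sum_option, Option.elim, one_mul, neg_mul, Finset.sum_neg_distrib, he,
    add_neg_cancel, ne_eq, OfNat.ofNat_ne_zero, not_false_eq_true, zero_pow, integral_zero] at key
  have hm : HasAllMoments (fun ω => rectIncrement (fun u => W u ω) a' b' +
      -∑ k, e k * rectIncrement (fun u => W u ω) (a k) (b k)) P := by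
    simp only [← Finset.sum_neg_distrib, ← neg_mul]
    exact (hW.rectIncrement_memLp _ _).add (HasAllMoments.sum _ fun k _ =>
      (HasAllMoments.const _).mul (hW.rectIncrement_memLp _ _))
  rw [integral_eq_zero_iff_of_nonneg (fun _ => sq_nonneg _) (hm.pow 2).integrable] at key
  filter_upwards [key] with ω hω
  have := pow_eq_zero_iff (two_ne_zero) |>.1 hω
  linarith

lemma IsBrownianSheet.hasAllMoments_integral [IsProbabilityMeasure P] (hW : IsBrownianSheet W P)
    (F : ElementaryIntegrand d q) : HasAllMoments (F.integral W) P :=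
  HasAllMoments.sum _ fun _ _ => (HasAllMoments.const _).mul
    (HasAllMoments.prod _ fun _ _ => hW.rectIncrement_memLp _ _)

/-- Comparison of moments for linear combinations of elementary multiple integrals. -/
theorem IsBrownianSheet.integral_sum_elementary_pow_le [IsProbabilityMeasure P]
    (hW : IsBrownianSheet W P) {V : Type*} [Fintype V] (α : V → ℝ)
    (F : V → ElementaryIntegrand d q) (m : ℕ) :
    Integrable (fun y => (∑ v, α v * (F v).eval y) ^ 2) ∧
    ∫ ω, (∑ v, α v * (F v).integral W ω) ^ (2 * m) ∂P
      ≤ (chaosConst q m * ∫ y, (∑ v, α v * (F v).eval y) ^ 2) ^ m := by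
  classical
  obtain ⟨g, hg, hG⟩ := exists_strictMono_nat_of_finset
    (Finset.univ.biUnion fun v : V => Finset.univ.biUnion fun k : Fin (F v).n =>
      Finset.univ.biUnion fun i : Fin d => {(F v).lower k i, (F v).upper k i})
  have hlow : ∀ v k i, ∃ p, g p = (F v).lower k i := fun v k i => hG _ (by
    simp only [Finset.mem_biUnion, Finset.mem_univ, true_and, Finset.mem_insert,
      Finset.mem_singleton]
    exact ⟨v, k, i, Or.inl rfl⟩)
  have hup : ∀ v k i, ∃ p, g p = (F v).upper k i := fun v k i => hG _ (by
    simp only [Finset.mem_biUnion, Finset.mem_univ, true_and, Finset.mem_insert,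
      Finset.mem_singleton]
    exact ⟨v, k, i, Or.inr rfl⟩)
  choose up hup using hup
  obtain ⟨N, hN⟩ : ∃ N, ∀ v k i, up v k i ≤ N := by
    refine ⟨∑ v, ∑ k, ∑ i, up v k i, fun v k i => ?_⟩
    calc up v k i ≤ ∑ i, up v k i :=
          Finset.single_le_sum (f := up v k) (fun _ _ => Nat.zero_le _) (Finset.mem_univ i)
      _ ≤ ∑ k, ∑ i, up v k i := Finset.single_le_sum (f := fun k => ∑ i, up v k i)
          (fun _ _ => Nat.zero_le _) (Finset.mem_univ k)
      _ ≤ _ := Finset.single_le_sum (f := fun v => ∑ k, ∑ i, up v k i)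
          (fun _ _ => Nat.zero_le _) (Finset.mem_univ v)
  have hbox : ∀ v k y, boxInd ((F v).lower k) ((F v).upper k) y
      = ∑ p : Fin d → Fin N, boxInd ((F v).lower k) ((F v).upper k) (gridUpper g p) *
        boxInd (gridLower g p) (gridUpper g p) y := fun v k y =>
    boxInd_grid hg (hlow v k) (fun i => ⟨up v k i, hN v k i, hup v k i⟩) y
  -- The combined integrand is constant on products of cells, so its value at their upper corners is
  -- its coefficient there.
  let c : (Fin q → Fin d → Fin N) → ℝ := fun ψ =>
    ∑ v, α v * (F v).eval (fun j => gridUpper g (ψ j))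
  have hc : ∀ ψ, ¬ Function.Injective ψ → c ψ = 0 := by
    intro ψ hψ
    refine Finset.sum_eq_zero fun v _ => ?_
    rw [(F v).eval_eq_zero_of_not_injective, mul_zero]
    intro hinj
    exact hψ fun j l hjl => hinj (by simp only [hjl])
  have heval : ∀ y : Fin q → Fin d → ℝ, ∑ v, α v * (F v).eval y
      = ∑ ψ, c ψ * ∏ j, boxInd (gridLower g (ψ j)) (gridUpper g (ψ j)) (y j) := by
    intro y
    have h1 : ∀ v, (F v).eval y = ∑ ψ : Fin q → Fin d → Fin N,
        (F v).eval (fun j => gridUpper g (ψ j)) *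
          ∏ j, boxInd (gridLower g (ψ j)) (gridUpper g (ψ j)) (y j) := fun v =>
      (F v).sum_coeff_mul_prod_eq (gridUpper g)
        (fun j k => boxInd ((F v).lower k) ((F v).upper k) (y j))
        (fun j p => boxInd (gridLower g p) (gridUpper g p) (y j)) fun j k => hbox v k (y j)
    simp only [h1, c, Finset.mul_sum, Finset.sum_mul]
    rw [Finset.sum_comm]
    exact Finset.sum_congr rfl fun ψ _ => Finset.sum_congr rfl fun v _ => by ring
  have hint : ∀ᵐ ω ∂P, ∑ v, α v * (F v).integral W ω
      = ∑ ψ, c ψ * ∏ j, rectIncrement (fun u => W u ω) (gridLower g (ψ j))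
          (gridUpper g (ψ j)) := by
    have hae : ∀ᵐ ω ∂P, ∀ v k, rectIncrement (fun u => W u ω) ((F v).lower k) ((F v).upper k)
        = ∑ p : Fin d → Fin N, boxInd ((F v).lower k) ((F v).upper k) (gridUpper g p) *
          rectIncrement (fun u => W u ω) (gridLower g p) (gridUpper g p) := by
      rw [ae_all_iff]
      intro v
      rw [ae_all_iff]
      intro k
      exact hW.rectIncrement_ae_eq_sum _ _ (gridLower_le_gridUpper hg)
        ((F v).lower_le_upper k) _ (hbox v k)
    filter_upwards [hae] with ω hω
    have h1 : ∀ v, (F v).integral W ω = ∑ ψ : Fin q → Fin d → Fin N,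
        (F v).eval (fun j => gridUpper g (ψ j)) *
          ∏ j, rectIncrement (fun u => W u ω) (gridLower g (ψ j)) (gridUpper g (ψ j)) := fun v =>
      (F v).sum_coeff_mul_prod_eq (gridUpper g)
        (fun _ k => rectIncrement (fun u => W u ω) ((F v).lower k) ((F v).upper k))
        (fun _ p => rectIncrement (fun u => W u ω) (gridLower g p) (gridUpper g p))
        fun j k => hω v k
    simp only [h1, c, Finset.mul_sum, Finset.sum_mul]
    rw [Finset.sum_comm]
    exact Finset.sum_congr rfl fun ψ _ => Finset.sum_congr rfl fun v _ => by ring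
  simp only [heval]
  refine ⟨(integral_sum_prod_boxInd_sq _ _ (fun k l => boxInd_grid_mul_of_ne hg) c).1, ?_⟩
  rw [integral_congr_ae (g := fun ω => (∑ ψ, c ψ * ∏ j, rectIncrement (fun u => W u ω)
    (gridLower g (ψ j)) (gridUpper g (ψ j))) ^ (2 * m))
    (by filter_upwards [hint] with ω hω; rw [hω])]
  exact hW.integral_offDiagonal_pow_le _ _ (gridLower_le_gridUpper hg)
    (fun k l => boxInd_grid_mul_of_ne hg) c hc m

lemma ElementaryIntegrand.measurable_eval (F : ElementaryIntegrand d q) : Measurable F.eval := by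
  have : F.eval = fun y => ∑ κ : Fin q → Fin F.n, F.coeff κ *
      ∏ j, boxInd (F.lower (κ j)) (F.upper (κ j)) (y j) := rfl
  rw [this]
  refine Finset.measurable_sum _ fun κ _ => measurable_const.mul (Finset.measurable_prod _
    fun j _ => (measurable_boxInd _ _).comp (measurable_pi_apply j))

/-- Comparison of norms for linear combinations of elementary multiple integrals. -/
theorem IsBrownianSheet.eLpNorm_sum_elementary_le [IsProbabilityMeasure P]
    (hW : IsBrownianSheet W P) {V : Type*} [Fintype V] (α : V → ℝ)
    (F : V → ElementaryIntegrand d q) {m : ℕ} (hm : m ≠ 0) :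
    eLpNorm (fun ω => ∑ v, α v * (F v).integral W ω) (2 * m : ℕ) P
      ≤ ENNReal.ofReal (Real.sqrt (chaosConst q m)) *
        eLpNorm (fun y => ∑ v, α v * (F v).eval y) 2 volume := by
  obtain ⟨hi, hle⟩ := hW.integral_sum_elementary_pow_le α F m
  have hmeas : Measurable fun y => ∑ v, α v * (F v).eval y :=
    Finset.measurable_sum _ fun v _ => measurable_const.mul (F v).measurable_eval
  have hL2 : MemLp (fun y => ∑ v, α v * (F v).eval y) 2 volume :=
    (memLp_two_iff_integrable_sq hmeas.aestronglyMeasurable).2 hi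
  have hLm : MemLp (fun ω => ∑ v, α v * (F v).integral W ω) (2 * m : ℕ) P :=
    HasAllMoments.sum _ (fun v _ => (HasAllMoments.const _).mul (hW.hasAllMoments_integral (F v)))
      _ (ENNReal.natCast_ne_top _)
  have hC := chaosConst_nonneg q m
  have hI : 0 ≤ ∫ y, (∑ v, α v * (F v).eval y) ^ 2 := integral_nonneg fun _ => sq_nonneg _
  rw [hLm.eLpNorm_eq_integral_rpow_norm (by simpa using hm) (ENNReal.natCast_ne_top _),
    hL2.eLpNorm_eq_integral_rpow_norm (by simp) (by simp),
    ← ENNReal.ofReal_mul (Real.sqrt_nonneg _)]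
  refine ENNReal.ofReal_le_ofReal ?_
  have e1 : ∀ x : ℝ, ‖x‖ ^ (((2 * m : ℕ) : ℝ≥0∞).toReal) = x ^ (2 * m) := by
    intro x
    rw [ENNReal.toReal_natCast, Real.rpow_natCast, Real.norm_eq_abs, pow_mul, pow_mul, sq_abs]
  have e2 : ∀ x : ℝ, ‖x‖ ^ ((2 : ℝ≥0∞).toReal) = x ^ 2 := by
    intro x
    rw [ENNReal.toReal_ofNat, ← Nat.cast_ofNat, Real.rpow_natCast, Real.norm_eq_abs, sq_abs]
  simp only [e1, e2]
  rw [ENNReal.toReal_natCast, ENNReal.toReal_ofNat]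
  have hm' : (m : ℝ) ≠ 0 := by exact_mod_cast hm
  calc (∫ ω, (∑ v, α v * (F v).integral W ω) ^ (2 * m) ∂P) ^ (((2 * m : ℕ) : ℝ))⁻¹
      ≤ ((chaosConst q m * ∫ y, (∑ v, α v * (F v).eval y) ^ 2) ^ m) ^ (((2 * m : ℕ) : ℝ))⁻¹ := by
        refine Real.rpow_le_rpow (integral_nonneg fun ω => ?_) hle (by positivity)
        simp only [pow_mul]; positivity
    _ = Real.sqrt (chaosConst q m * ∫ y, (∑ v, α v * (F v).eval y) ^ 2) := by
        rw [Real.sqrt_eq_rpow, ← Real.rpow_natCast, ← Real.rpow_mul (by positivity)]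
        congr 1
        push_cast
        field_simp
    _ = _ := by
        rw [Real.sqrt_mul hC, Real.sqrt_eq_rpow (∫ y, _)]
        norm_num

/-- Comparison of norms for linear combinations of multiple Wiener integrals. -/
theorem IsBrownianSheet.eLpNorm_sum_wiener_le [IsProbabilityMeasure P]
    (hW : IsBrownianSheet W P) {V : Type*} [Fintype V] (α : V → ℝ)
    {f : V → (Fin q → Fin d → ℝ) → ℝ} {X : V → Ω → ℝ}
    (hX : ∀ v, IsMultipleWienerIntegral W P (f v) (X v)) {m : ℕ} (hm : m ≠ 0) :
    eLpNorm (fun ω => ∑ v, α v * X v ω) (2 * m : ℕ) P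
      ≤ ENNReal.ofReal (Real.sqrt (chaosConst q m)) *
        eLpNorm (fun y => ∑ v, α v * f v y) 2 volume := by
  choose F hFf hFX using fun v => (hX v).exists_approx
  have hmA : ∀ n v, AEStronglyMeasurable ((F v n).integral W) P := fun n v =>
    (hW.hasAllMoments_integral (F v n)).integrable.aestronglyMeasurable
  have hmB : ∀ v, AEStronglyMeasurable (X v) P := fun v => (hX v).memLp.aestronglyMeasurable
  have hmA' : ∀ n v, AEStronglyMeasurable ((F v n).eval) volume := fun n v =>
    (F v n).measurable_eval.aestronglyMeasurable
  have hmB' : ∀ v, AEStronglyMeasurable (f v) volume :=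
    fun v => (hX v).memLp_integrand.aestronglyMeasurable
  have hX2 := tendsto_eLpNorm_sum_sub α hmA hmB hFX
  have hf2 := tendsto_eLpNorm_sum_sub α hmA' hmB' hFf
  have hmY : ∀ n, AEStronglyMeasurable (fun ω => ∑ v, α v * (F v n).integral W ω) P := fun n =>
    Finset.aestronglyMeasurable_fun_sum _ fun v _ => (hmA n v).const_mul _
  -- `L²` convergence gives almost sure convergence along a subsequence, and Fatou then bounds the
  -- `L^(2m)` norm of the limit without prior knowledge that it is finite.
  obtain ⟨ns, hns, hae⟩ := (tendstoInMeasure_of_tendsto_eLpNorm (by simp) hmY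
    (Finset.aestronglyMeasurable_fun_sum _ fun v _ => (hmB v).const_mul _)
    hX2).exists_seq_tendsto_ae
  refine (Lp.eLpNorm_lim_le_liminf_eLpNorm (fun n => hmY (ns n)) _ hae).trans ?_
  have hbound : ∀ n, eLpNorm (fun ω => ∑ v, α v * (F v (ns n)).integral W ω) (2 * m : ℕ) P
      ≤ ENNReal.ofReal (Real.sqrt (chaosConst q m)) *
        (eLpNorm ((fun y => ∑ v, α v * (F v (ns n)).eval y) - fun y => ∑ v, α v * f v y) 2 volume
          + eLpNorm (fun y => ∑ v, α v * f v y) 2 volume) := by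
    intro n
    refine (hW.eLpNorm_sum_elementary_le α (fun v => F v (ns n)) hm).trans ?_
    gcongr
    have h1 : AEStronglyMeasurable (fun y => ∑ v, α v * (F v (ns n)).eval y) volume :=
      Finset.aestronglyMeasurable_fun_sum _ fun v _ => (hmA' _ v).const_mul _
    have h2 : AEStronglyMeasurable (fun y => ∑ v, α v * f v y) volume :=
      Finset.aestronglyMeasurable_fun_sum _ fun v _ => (hmB' v).const_mul _
    have := eLpNorm_add_le (p := 2) (h1.sub h2) h2 (by simp)
    simpa using this
  have hlim : Tendsto (fun n => ENNReal.ofReal (Real.sqrt (chaosConst q m)) *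
        (eLpNorm ((fun y => ∑ v, α v * (F v (ns n)).eval y) - fun y => ∑ v, α v * f v y) 2 volume
          + eLpNorm (fun y => ∑ v, α v * f v y) 2 volume)) atTop
      (𝓝 (ENNReal.ofReal (Real.sqrt (chaosConst q m)) *
        (0 + eLpNorm (fun y => ∑ v, α v * f v y) 2 volume))) :=
    ENNReal.Tendsto.const_mul ((hf2.comp hns.tendsto_atTop).add tendsto_const_nhds)
      (Or.inr ENNReal.ofReal_ne_top)
  rw [zero_add] at hlim
  exact (liminf_le_liminf (Eventually.of_forall hbound)).trans hlim.liminf_eq.le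

end Chaos

/-! ### The `L²` norm of increments of the kernel. -/

/-- Tonelli's theorem for a product of functions of one coordinate. -/
theorem lintegral_fin_prod_eq_prod {n : ℕ} {E : Type*} [MeasurableSpace E]
    (μ : Fin n → Measure E) [∀ i, SigmaFinite (μ i)]
    {f : Fin n → E → ℝ≥0∞} (hf : ∀ i, Measurable (f i)) :
    ∫⁻ x : Fin n → E, ∏ i, f i (x i) ∂(Measure.pi μ) = ∏ i, ∫⁻ x, f i x ∂(μ i) := by
  induction n with
  | zero => simp
  | succ n ih =>
    have hm : Measurable fun x : Fin n → E => ∏ i, f i.succ (x i) :=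
      Finset.measurable_prod _ fun i _ => (hf i.succ).comp (measurable_pi_apply i)
    have h := (measurePreserving_piFinSuccAbove μ 0).lintegral_comp_emb
      (MeasurableEquiv.measurableEmbedding _)
      (fun z : E × (Fin n → E) => f 0 z.1 * ∏ i : Fin n, f i.succ (z.2 i))
    have e : ∀ x : Fin (n + 1) → E,
        f 0 ((MeasurableEquiv.piFinSuccAbove (fun _ => E) 0) x).1 *
          ∏ i : Fin n, f i.succ (((MeasurableEquiv.piFinSuccAbove (fun _ => E) 0) x).2 i)
        = ∏ i, f i (x i) := by
      intro x
      rw [Fin.prod_univ_succ]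
      rfl
    simp only [e] at h
    rw [h, lintegral_prod_mul (hf 0).aemeasurable hm.aemeasurable, Fin.prod_univ_succ,
      ← ih (fun i => μ i.succ) fun i => hf i.succ]
    rfl

lemma lintegral_Ioc_rpow {a h : ℝ} (ha : a < 1) (hh : 0 ≤ h) :
    ∫⁻ w in Set.Ioc 0 h, ENNReal.ofReal (w ^ (-a)) = ENNReal.ofReal (h ^ (1 - a) / (1 - a)) := by
  have hi : IntervalIntegrable (fun w : ℝ => w ^ (-a)) volume 0 h :=
    intervalIntegral.intervalIntegrable_rpow' (by linarith)
  rw [← ofReal_integral_eq_lintegral_ofReal]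
  · rw [← intervalIntegral.integral_of_le hh, integral_rpow (Or.inl (by linarith))]
    rw [Real.zero_rpow (by linarith), sub_zero]
    ring_nf
  · exact (intervalIntegrable_iff_integrableOn_Ioc_of_le hh).1 hi
  · exact (ae_restrict_mem measurableSet_Ioc).mono fun w hw => Real.rpow_nonneg hw.1.le _

lemma lintegral_Ioi_rpow {a h : ℝ} (ha : 1 < a) (hh : 0 < h) :
    ∫⁻ w in Set.Ioi h, ENNReal.ofReal (w ^ (-a)) = ENNReal.ofReal (h ^ (1 - a) / (a - 1)) := by
  rw [← ofReal_integral_eq_lintegral_ofReal]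
  · rw [integral_Ioi_rpow_of_lt (by linarith) hh]
    congr 1
    rw [← neg_div_neg_eq, neg_neg]
    ring_nf
  · exact integrableOn_Ioi_rpow_of_lt (by linarith) hh
  · exact (ae_restrict_mem measurableSet_Ioi).mono fun w hw =>
      Real.rpow_nonneg (hh.trans hw).le _

/-- The one-sided power `u₊ ^ (-a)`. -/
noncomputable def posRpow (a u : ℝ) : ℝ := (max u 0) ^ (-a)

lemma posRpow_nonneg (a u : ℝ) : 0 ≤ posRpow a u := Real.rpow_nonneg (le_max_right _ _) _

lemma posRpow_of_nonpos {a u : ℝ} (ha : a ≠ 0) (hu : u ≤ 0) : posRpow a u = 0 := by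
  rw [posRpow, max_eq_right hu, Real.zero_rpow (by simpa using ha)]

lemma posRpow_of_pos {a u : ℝ} (hu : 0 < u) : posRpow a u = u ^ (-a) := by
  rw [posRpow, max_eq_left hu.le]

lemma measurable_posRpow (a : ℝ) : Measurable (posRpow a) := by
  unfold posRpow; fun_prop

/-- The correlation of two one-sided powers. -/
lemma lintegral_posRpow_mul_le_of_lt {a u v : ℝ} (ha : 1 / 2 < a) (ha' : a < 1) (huv : u < v) :
    ∫⁻ x, ENNReal.ofReal (posRpow a (u - x)) * ENNReal.ofReal (posRpow a (v - x))
      ≤ ENNReal.ofReal ((1 / (1 - a) + 1 / (2 * a - 1)) * |u - v| ^ (1 - 2 * a)) := by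
  set h := v - u with hh
  have hpos : 0 < h := sub_pos.2 huv
  have e : ∀ x, v - x = (u - x) + h := fun x => by rw [hh]; ring
  simp only [e]
  rw [lintegral_sub_left_eq_self (fun w => ENNReal.ofReal (posRpow a w) *
    ENNReal.ofReal (posRpow a (w + h))) u]
  have habs : |u - v| = h := by rw [abs_sub_comm, abs_of_pos hpos]
  rw [habs]
  -- With `w = u - x`, the factor `(w+h)^(-a)` is at most `h^(-a)` for `w ≤ h` and at most `w^(-a)`
  -- beyond. The first piece is integrable at `0` since `a < 1`, the second at infinity since `2a >
  -- 1`, and both scale as `h^(1-2a)`.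
  calc ∫⁻ w, ENNReal.ofReal (posRpow a w) * ENNReal.ofReal (posRpow a (w + h))
      ≤ ∫⁻ w, ((Set.Ioc 0 h).indicator
            (fun w => ENNReal.ofReal (h ^ (-a)) * ENNReal.ofReal (w ^ (-a))) w +
          (Set.Ioi h).indicator (fun w => ENNReal.ofReal (w ^ (-(2 * a)))) w) := by
        refine lintegral_mono fun w => ?_
        rcases le_or_gt w 0 with hw | hw
        · simp [posRpow_of_nonpos (by linarith : a ≠ 0) hw]
        rw [posRpow_of_pos hw, posRpow_of_pos (by linarith)]
        rcases le_or_gt w h with hwh | hwh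
        · rw [Set.indicator_of_mem (s := Set.Ioc 0 h) ⟨hw, hwh⟩, mul_comm]
          refine le_add_right (mul_le_mul_left ?_ _)
          exact ENNReal.ofReal_le_ofReal
            (Real.rpow_le_rpow_of_nonpos hpos (by linarith) (by linarith))
        · rw [Set.indicator_of_mem (s := Set.Ioi h) hwh]
          refine le_add_left ?_
          rw [← ENNReal.ofReal_mul (by positivity)]
          refine ENNReal.ofReal_le_ofReal ?_
          rw [show -(2 * a) = -a + -a by ring, Real.rpow_add hw]
          exact mul_le_mul_of_nonneg_left
            (Real.rpow_le_rpow_of_nonpos hw (by linarith) (by linarith)) (by positivity)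
    _ = ENNReal.ofReal ((1 / (1 - a) + 1 / (2 * a - 1)) * h ^ (1 - 2 * a)) := by
        rw [lintegral_add_left, lintegral_indicator measurableSet_Ioc,
          lintegral_indicator measurableSet_Ioi, lintegral_const_mul, lintegral_Ioc_rpow ha' hpos.le,
          lintegral_Ioi_rpow (by linarith) hpos, ← ENNReal.ofReal_mul (by positivity),
          ← ENNReal.ofReal_add]
        · congr 1
          rw [show 1 - 2 * a = -a + (1 - a) by ring, Real.rpow_add hpos]
          ring
        · have : 0 < 1 - a := by linarith
          positivity
        · have : 0 < 2 * a - 1 := by linarith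
          positivity
        · fun_prop
        · exact Measurable.indicator (by fun_prop) measurableSet_Ioc

lemma lintegral_posRpow_mul_le {a u v : ℝ} (ha : 1 / 2 < a) (ha' : a < 1) (huv : u ≠ v) :
    ∫⁻ x, ENNReal.ofReal (posRpow a (u - x)) * ENNReal.ofReal (posRpow a (v - x))
      ≤ ENNReal.ofReal ((1 / (1 - a) + 1 / (2 * a - 1)) * |u - v| ^ (1 - 2 * a)) := by
  rcases lt_or_gt_of_ne huv with h | h
  · exact lintegral_posRpow_mul_le_of_lt ha ha' h
  · rw [abs_sub_comm]
    simpa only [mul_comm] using lintegral_posRpow_mul_le_of_lt ha ha' h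

/-- On each side of `u` the distance runs through at most `(0, β - α]`, whence the factor `2`. The
last term has integral zero; being infinite at `v = u`, it makes the pointwise bound trivial at the
singularity. -/
lemma lintegral_Ioc_abs_sub_rpow_le {γ α β u : ℝ} (hγ : γ < 1) (hu : u ∈ Set.Ioc α β) :
    ∫⁻ v in Set.Ioc α β, ENNReal.ofReal (|u - v| ^ (-γ))
      ≤ ENNReal.ofReal (2 * ((β - α) ^ (1 - γ) / (1 - γ)))
        + ∫⁻ v in Set.Ioc α β, Set.indicator {u} (fun _ => ∞) v := by
  have hL : 0 ≤ β - α := by linarith [hu.1, hu.2]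
  let f : ℝ → ℝ≥0∞ := (Set.Ioc 0 (β - α)).indicator fun w => ENNReal.ofReal (w ^ (-γ))
  have hfm : Measurable f := Measurable.indicator (by fun_prop) measurableSet_Ioc
  have hf : ∫⁻ w, f w = ENNReal.ofReal ((β - α) ^ (1 - γ) / (1 - γ)) := by
    rw [lintegral_indicator measurableSet_Ioc, lintegral_Ioc_rpow hγ hL]
  calc ∫⁻ v in Set.Ioc α β, ENNReal.ofReal (|u - v| ^ (-γ))
      ≤ ∫⁻ v in Set.Ioc α β, ((f (v - u) + f (u - v)) + Set.indicator {u} (fun _ => ∞) v) := by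
        refine setLIntegral_mono' measurableSet_Ioc fun v hv => ?_
        rcases lt_trichotomy u v with h | h | h
        · refine le_add_right (le_add_right ?_)
          simp only [f]
          rw [Set.indicator_of_mem (s := Set.Ioc 0 (β - α)) ⟨by linarith, by linarith [hu.1, hv.2]⟩,
            abs_sub_comm, abs_of_pos (by linarith)]
        · simp [h]
        · refine le_add_right (le_add_left ?_)
          simp only [f]
          rw [Set.indicator_of_mem (s := Set.Ioc 0 (β - α)) ⟨by linarith, by linarith [hv.1, hu.2]⟩,
            abs_of_pos (by linarith)]
    _ = (∫⁻ v in Set.Ioc α β, (f (v - u) + f (u - v))) +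
        ∫⁻ v in Set.Ioc α β, Set.indicator {u} (fun _ => ∞) v := by
        rw [lintegral_add_left (by fun_prop)]
    _ ≤ _ := by
        gcongr
        calc ∫⁻ v in Set.Ioc α β, (f (v - u) + f (u - v))
            ≤ ∫⁻ v, (f (v - u) + f (u - v)) := setLIntegral_le_lintegral _ _
          _ = _ := by
            rw [lintegral_add_left (by fun_prop), lintegral_sub_right_eq_self f u,
              lintegral_sub_left_eq_self f u, hf, ← two_mul,
              ENNReal.ofReal_mul (by norm_num), ENNReal.ofReal_ofNat]

/-- The double integral of a correlation power over a square. -/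
lemma lintegral_lintegral_correlation_pow_le {a γ : ℝ} (ha : 1 / 2 < a) (ha' : a < 1) (q : ℕ)
    (hγ : (1 - 2 * a) * q = -γ) (hγ1 : γ < 1) :
    ∃ C : ℝ, 0 ≤ C ∧ ∀ α β : ℝ, α ≤ β →
      ∫⁻ u in Set.Ioc α β, ∫⁻ v in Set.Ioc α β,
        (∫⁻ x, ENNReal.ofReal (posRpow a (u - x)) * ENNReal.ofReal (posRpow a (v - x))) ^ q
      ≤ ENNReal.ofReal (C * (β - α) ^ (2 - γ)) := by
  set c := 1 / (1 - a) + 1 / (2 * a - 1) with hc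
  have hc0 : 0 ≤ c := by
    have h1 : 0 < 1 - a := by linarith
    have h2 : 0 < 2 * a - 1 := by linarith
    positivity
  have hγ' : 0 < 1 - γ := by linarith
  refine ⟨c ^ q * (2 / (1 - γ)), by positivity, fun α β hαβ => ?_⟩
  have hsing : ∀ u : ℝ, ∀ᵐ v ∂(volume.restrict (Set.Ioc α β)), u ≠ v := by
    intro u
    refine ae_restrict_of_ae ?_
    have : ∀ᵐ v ∂(volume : Measure ℝ), v ∉ ({u} : Set ℝ) :=
      measure_eq_zero_iff_ae_notMem.1 (by simp)
    filter_upwards [this] with v hv h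
    exact hv (by simp [h])
  have hinner : ∀ u ∈ Set.Ioc α β, ∫⁻ v in Set.Ioc α β,
        (∫⁻ x, ENNReal.ofReal (posRpow a (u - x)) * ENNReal.ofReal (posRpow a (v - x))) ^ q
      ≤ ENNReal.ofReal (c ^ q) * ENNReal.ofReal (2 * ((β - α) ^ (1 - γ) / (1 - γ))) := by
    intro u hu
    calc _ ≤ ∫⁻ v in Set.Ioc α β, ENNReal.ofReal (c ^ q) * ENNReal.ofReal (|u - v| ^ (-γ)) := by
          refine lintegral_mono_ae ?_
          filter_upwards [hsing u] with v hv
          refine (pow_le_pow_left' (lintegral_posRpow_mul_le ha ha' hv) q).trans ?_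
          rw [← ENNReal.ofReal_pow (by positivity), mul_pow, ← ENNReal.ofReal_mul (by positivity),
            ← Real.rpow_natCast (|u - v| ^ (1 - 2 * a)), ← Real.rpow_mul (abs_nonneg _), hγ]
      _ = ENNReal.ofReal (c ^ q) * ∫⁻ v in Set.Ioc α β, ENNReal.ofReal (|u - v| ^ (-γ)) :=
          lintegral_const_mul _ (by fun_prop)
      _ ≤ _ := by
          gcongr
          refine (lintegral_Ioc_abs_sub_rpow_le hγ1 hu).trans ?_
          have : ∫⁻ v in Set.Ioc α β, Set.indicator {u} (fun _ => (∞ : ℝ≥0∞)) v = 0 := by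
            rw [lintegral_eq_zero_iff (measurable_const.indicator (measurableSet_singleton u))]
            filter_upwards [hsing u] with v hv
            exact Set.indicator_of_notMem (fun h => hv (Set.mem_singleton_iff.1 h).symm) _
          rw [this, add_zero]
  calc _ ≤ ∫⁻ _ in Set.Ioc α β, ENNReal.ofReal (c ^ q) *
          ENNReal.ofReal (2 * ((β - α) ^ (1 - γ) / (1 - γ))) :=
        setLIntegral_mono' measurableSet_Ioc hinner
    _ = _ := by
        have hL : 0 ≤ β - α := by linarith
        rw [setLIntegral_const, Real.volume_Ioc, ← ENNReal.ofReal_mul (by positivity),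
          ← ENNReal.ofReal_mul (by positivity)]
        congr 1
        rcases hL.eq_or_lt with h0 | h0
        · rw [← h0, Real.zero_rpow (by linarith : 2 - γ ≠ 0)]; ring
        · rw [show 2 - γ = (1 - γ) + 1 by ring, Real.rpow_add h0, Real.rpow_one]; ring

/-- The primitive, in one coordinate, of the product of `q` one-sided powers. -/
noncomputable def kernelPrimitive {q : ℕ} (a : ℝ) (z : Fin q → ℝ) (t : ℝ) : ℝ :=
  ∫ u in Set.Icc 0 t, ∏ j, posRpow a (u - z j)

/-- The integrand is a product over coordinates and the domain is a box. The factorisation needs no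
integrability. -/
lemma hermiteKernel_eq_prod {d q : ℕ} (H : Fin d → ℝ) (t : Fin d → ℝ) (y : Fin q → Fin d → ℝ) :
    hermiteKernel q H t y =
      ∏ i, kernelPrimitive (1 / 2 + (1 - H i) / (q : ℝ)) (fun j => y j i) (t i) := by
  unfold hermiteKernel kernelPrimitive
  rw [← Set.pi_univ_Icc, volume_pi, Measure.restrict_pi_pi, ← integral_fintype_prod_eq_prod]
  congr 1 with s
  rw [Finset.prod_comm]
  rfl

/-- Integrability is not assumed, since for exceptional `y` the kernel may fail to be integrable. If
it fails on `[0, s]`, both integrals take the default value `0`; if it fails only on `(s, t]`, the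
right-hand side is infinite. -/
lemma ofReal_abs_integral_Icc_sub_le {g : ℝ → ℝ} (hg : ∀ u, 0 ≤ g u) (hgm : Measurable g)
    {s t : ℝ} (hs : 0 ≤ s) (hst : s ≤ t) :
    ENNReal.ofReal |(∫ u in Set.Icc 0 t, g u) - ∫ u in Set.Icc 0 s, g u|
      ≤ ∫⁻ u in Set.Ioc s t, ENNReal.ofReal (g u) := by
  have hU : Set.Icc 0 t = Set.Icc 0 s ∪ Set.Ioc s t := (Set.Icc_union_Ioc_eq_Icc hs hst).symm
  by_cases hf : ∫⁻ u in Set.Ioc s t, ENNReal.ofReal (g u) = ∞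
  · rw [hf]; exact le_top
  have hi : IntegrableOn g (Set.Ioc s t) :=
    ⟨hgm.aestronglyMeasurable, by
      rw [hasFiniteIntegral_iff_ofReal (Eventually.of_forall hg)]
      exact lt_top_iff_ne_top.2 hf⟩
  by_cases h0 : IntegrableOn g (Set.Icc 0 s)
  · have hd : Disjoint (Set.Icc 0 s) (Set.Ioc s t) :=
      Set.disjoint_left.2 fun x hx hx' => absurd hx.2 (not_le.2 hx'.1)
    rw [hU, setIntegral_union hd measurableSet_Ioc h0 hi, add_sub_cancel_left,
      abs_of_nonneg (integral_nonneg hg),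
      ofReal_integral_eq_lintegral_ofReal hi (Eventually.of_forall hg)]
  · have h1 : ¬ IntegrableOn g (Set.Icc 0 t) := fun h =>
      h0 (h.mono_set (Set.Icc_subset_Icc_right hst))
    rw [integral_undef h0, integral_undef h1]
    simp

lemma ofReal_abs_kernelPrimitive_sub_le {q : ℕ} (a : ℝ) (z : Fin q → ℝ) {s t : ℝ}
    (hs : 0 ≤ s) (ht : 0 ≤ t) :
    ENNReal.ofReal |kernelPrimitive a z t - kernelPrimitive a z s|
      ≤ ∫⁻ u in Set.uIoc s t, ∏ j, ENNReal.ofReal (posRpow a (u - z j)) := by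
  have h0 : ∀ u, 0 ≤ ∏ j, posRpow a (u - z j) :=
    fun u => Finset.prod_nonneg fun j _ => posRpow_nonneg _ _
  have hm : Measurable fun u => ∏ j, posRpow a (u - z j) :=
    Finset.measurable_prod _ fun j _ => (measurable_posRpow a).comp (by fun_prop)
  simp only [← ENNReal.ofReal_prod_of_nonneg fun j _ => posRpow_nonneg _ _]
  rcases le_total s t with h | h
  · rw [Set.uIoc_of_le h]
    exact ofReal_abs_integral_Icc_sub_le h0 hm hs h
  · rw [Set.uIoc_of_ge h, abs_sub_comm]
    exact ofReal_abs_integral_Icc_sub_le h0 hm ht h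

/-- The square norm of a kernel of product form. -/
lemma lintegral_sq_lintegral_prod_eq {d q : ℕ} (φ : Fin d → ℝ → ℝ≥0∞) (hφ : ∀ i, Measurable (φ i))
    (ν : Fin d → Measure ℝ) [∀ i, SigmaFinite (ν i)] :
    ∫⁻ y : Fin q → Fin d → ℝ, (∏ i, ∫⁻ u, ∏ j, φ i (u - y j i) ∂(ν i)) ^ 2
      = ∏ i, ∫⁻ u, ∫⁻ v, (∫⁻ x, φ i (u - x) * φ i (v - x)) ^ q ∂(ν i) ∂(ν i) := by
  have hI : ∀ i, Measurable fun p : ℝ × ℝ => (∫⁻ x, φ i (p.1 - x) * φ i (p.2 - x)) ^ q := by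
    intro i
    refine Measurable.pow_const ?_ q
    refine Measurable.lintegral_prod_right' (f := fun p : (ℝ × ℝ) × ℝ =>
      φ i (p.1.1 - p.2) * φ i (p.1.2 - p.2)) ?_
    exact ((hφ i).comp (by fun_prop)).mul ((hφ i).comp (by fun_prop))
  have h1 : ∀ y : Fin q → Fin d → ℝ, (∏ i, ∫⁻ u, ∏ j, φ i (u - y j i) ∂(ν i)) ^ 2
      = ∫⁻ u, ∫⁻ v, ∏ j, ∏ i, (φ i (u i - y j i) * φ i (v i - y j i))
          ∂(Measure.pi ν) ∂(Measure.pi ν) := by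
    intro y
    have hm : ∀ i, Measurable fun u => ∏ j, φ i (u - y j i) := fun i =>
      Finset.measurable_prod _ fun j _ => (hφ i).comp (by fun_prop)
    have hm' : Measurable fun u : Fin d → ℝ => ∏ i, ∏ j, φ i (u i - y j i) :=
      Finset.measurable_prod _ fun i _ => (hm i).comp (measurable_pi_apply i)
    rw [← lintegral_fin_prod_eq_prod ν hm, pow_two, ← lintegral_mul_const _ hm']
    refine lintegral_congr fun u => ?_
    rw [← lintegral_const_mul _ hm']
    refine lintegral_congr fun v => ?_
    rw [← Finset.prod_mul_distrib, Finset.prod_comm]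
    exact Finset.prod_congr rfl fun i _ => by rw [← Finset.prod_mul_distrib]
  have hjoint : Measurable fun p : ((Fin q → Fin d → ℝ) × (Fin d → ℝ)) × (Fin d → ℝ) =>
      ∏ j, ∏ i, (φ i (p.1.2 i - p.1.1 j i) * φ i (p.2 i - p.1.1 j i)) :=
    Finset.measurable_prod _ fun j _ => Finset.measurable_prod _ fun i _ =>
      ((hφ i).comp (by fun_prop)).mul ((hφ i).comp (by fun_prop))
  have h2 : ∀ u v : Fin d → ℝ,
      ∫⁻ y : Fin q → Fin d → ℝ, ∏ j, ∏ i, (φ i (u i - y j i) * φ i (v i - y j i))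
      = ∏ i, (∫⁻ x, φ i (u i - x) * φ i (v i - x)) ^ q := by
    intro u v
    have hm : ∀ i, Measurable fun x => φ i (u i - x) * φ i (v i - x) := fun i =>
      ((hφ i).comp (by fun_prop)).mul ((hφ i).comp (by fun_prop))
    rw [volume_pi, lintegral_fin_prod_eq_prod (fun _ : Fin q => (volume : Measure (Fin d → ℝ)))
      (f := fun _ x => ∏ i, (φ i (u i - x i) * φ i (v i - x i)))
      (fun _ => Finset.measurable_prod _ fun i _ => (hm i).comp (measurable_pi_apply i)),
      Finset.prod_const, Finset.card_univ, Fintype.card_fin, volume_pi,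
      lintegral_fin_prod_eq_prod _ hm, Finset.prod_pow]
  simp only [h1]
  rw [lintegral_lintegral_swap]
  swap
  · exact (Measurable.lintegral_prod_right' hjoint).aemeasurable
  calc _ = ∫⁻ u : Fin d → ℝ, ∫⁻ v : Fin d → ℝ, (∫⁻ y : Fin q → Fin d → ℝ,
        ∏ j, ∏ i, (φ i (u i - y j i) * φ i (v i - y j i))) ∂(Measure.pi ν) ∂(Measure.pi ν) := by
        refine lintegral_congr fun u => ?_
        rw [lintegral_lintegral_swap]
        refine Measurable.aemeasurable ?_
        exact hjoint.comp (g := fun p : ((Fin q → Fin d → ℝ) × (Fin d → ℝ)) × (Fin d → ℝ) => _)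
          (f := fun p : (Fin q → Fin d → ℝ) × (Fin d → ℝ) => ((p.1, u), p.2)) (by fun_prop)
    _ = ∫⁻ u, ∏ i, ∫⁻ v, (∫⁻ x, φ i (u i - x) * φ i (v - x)) ^ q ∂(ν i) ∂(Measure.pi ν) := by
        refine lintegral_congr fun u => ?_
        simp only [h2]
        rw [lintegral_fin_prod_eq_prod ν (f := fun i v => (∫⁻ x, φ i (u i - x) * φ i (v - x)) ^ q)]
        exact fun i => (hI i).comp (measurable_prodMk_left (x := u i))
    _ = _ := by
        rw [lintegral_fin_prod_eq_prod ν
          (f := fun i u => ∫⁻ v, (∫⁻ x, φ i (u - x) * φ i (v - x)) ^ q ∂(ν i))]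
        exact fun i => Measurable.lintegral_prod_right' (hI i)

/-- The `L²` norm of the rectangular increments of the Hermite kernel. -/
theorem eLpNorm_rectIncrement_hermiteKernel_le {d q : ℕ} (hq : 1 ≤ q) {H : Fin d → ℝ}
    (hH : ∀ i, 1 / 2 < H i ∧ H i < 1) :
    ∃ C : ℝ, 0 ≤ C ∧ ∀ s t : Fin d → ℝ, 0 ≤ s → 0 ≤ t →
      eLpNorm (fun y : Fin q → Fin d → ℝ => rectIncrement (fun u => hermiteKernel q H u y) s t) 2
        volume ≤ ENNReal.ofReal (C * ∏ i, |t i - s i| ^ H i) := by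
  have hq0 : (0 : ℝ) < q := by exact_mod_cast hq
  have hq1 : (1 : ℝ) ≤ q := by exact_mod_cast hq
  set a : Fin d → ℝ := fun i => 1 / 2 + (1 - H i) / (q : ℝ) with ha
  have ha1 : ∀ i, 1 / 2 < a i := fun i => by
    have : 0 < (1 - H i) / (q : ℝ) := div_pos (by linarith [(hH i).2]) hq0
    simp only [ha]; linarith
  have ha2 : ∀ i, a i < 1 := fun i => by
    have : (1 - H i) / (q : ℝ) ≤ 1 - H i := div_le_self (by linarith [(hH i).2]) hq1
    simp only [ha]; linarith [(hH i).1]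
  -- So `γ = 2 - 2 H i`, which is less than `1` because `H i > 1/2`, and the double integral scales
  -- with exponent `2 - γ = 2 H i`.
  have hγ : ∀ i, (1 - 2 * a i) * q = -(2 - 2 * H i) := fun i => by
    simp only [ha]; field_simp; ring
  choose C hC0 hC using fun i => lintegral_lintegral_correlation_pow_le (ha1 i) (ha2 i) q (hγ i)
    (by linarith [(hH i).1])
  refine ⟨Real.sqrt (∏ i, C i), Real.sqrt_nonneg _, fun s t hs ht => ?_⟩
  have hfac : ∀ y : Fin q → Fin d → ℝ, rectIncrement (fun u => hermiteKernel q H u y) s t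
      = ∏ i, (kernelPrimitive (a i) (fun j => y j i) (t i) -
          kernelPrimitive (a i) (fun j => y j i) (s i)) := by
    intro y
    simp only [hermiteKernel_eq_prod]
    exact rectIncrement_prod (fun i x => kernelPrimitive (a i) (fun j => y j i) x) s t
  have hpt : ∀ y : Fin q → Fin d → ℝ,
      ‖rectIncrement (fun u => hermiteKernel q H u y) s t‖ₑ
        ≤ ∏ i, ∫⁻ u in Set.uIoc (s i) (t i), ∏ j, ENNReal.ofReal (posRpow (a i) (u - y j i)) := by
    intro y
    rw [hfac, Real.enorm_eq_ofReal_abs, Finset.abs_prod,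
      ENNReal.ofReal_prod_of_nonneg fun i _ => abs_nonneg _]
    exact Finset.prod_le_prod' fun i _ => ofReal_abs_kernelPrimitive_sub_le _ _ (hs i) (ht i)
  have hsq : ∫⁻ y : Fin q → Fin d → ℝ,
      ‖rectIncrement (fun u => hermiteKernel q H u y) s t‖ₑ ^ 2
      ≤ ENNReal.ofReal ((∏ i, C i) * (∏ i, |t i - s i| ^ H i) ^ 2) := by
    calc _ ≤ ∫⁻ y : Fin q → Fin d → ℝ, (∏ i, ∫⁻ u in Set.uIoc (s i) (t i),
          ∏ j, ENNReal.ofReal (posRpow (a i) (u - y j i))) ^ 2 :=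
          lintegral_mono fun y => pow_le_pow_left' (hpt y) 2
      _ = ∏ i, ∫⁻ u in Set.uIoc (s i) (t i), ∫⁻ v in Set.uIoc (s i) (t i),
          (∫⁻ x, ENNReal.ofReal (posRpow (a i) (u - x)) *
            ENNReal.ofReal (posRpow (a i) (v - x))) ^ q :=
          lintegral_sq_lintegral_prod_eq (fun i x => ENNReal.ofReal (posRpow (a i) x))
            (fun i => (measurable_posRpow _).ennreal_ofReal)
            (fun i => volume.restrict (Set.uIoc (s i) (t i)))
      _ ≤ ∏ i, ENNReal.ofReal (C i * |t i - s i| ^ (2 * H i)) := by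
          refine Finset.prod_le_prod' fun i _ => ?_
          have := hC i (min (s i) (t i)) (max (s i) (t i)) min_le_max
          rw [max_sub_min_eq_abs, sub_sub_cancel] at this
          exact this
      _ = _ := by
          rw [← ENNReal.ofReal_prod_of_nonneg fun i _ =>
            mul_nonneg (hC0 i) (Real.rpow_nonneg (abs_nonneg _) _), Finset.prod_mul_distrib,
            ← Finset.prod_pow]
          congr 3 with i
          rw [mul_comm, Real.rpow_mul (abs_nonneg _), ← Nat.cast_ofNat (n := 2), Real.rpow_natCast]
  rw [eLpNorm_eq_lintegral_rpow_enorm_toReal (by simp) (by simp), ENNReal.toReal_ofNat]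
  have e : ∀ x : ℝ≥0∞, x ^ (2 : ℝ) = x ^ 2 := fun x => by
    rw [← Nat.cast_ofNat, ENNReal.rpow_natCast]
  simp only [e]
  have hP : 0 ≤ ∏ i, |t i - s i| ^ H i :=
    Finset.prod_nonneg fun i _ => Real.rpow_nonneg (abs_nonneg _) _
  have hPC : 0 ≤ ∏ i, C i := Finset.prod_nonneg fun i _ => hC0 i
  calc _ ≤ (ENNReal.ofReal ((∏ i, C i) * (∏ i, |t i - s i| ^ H i) ^ 2)) ^ (1 / (2 : ℝ)) := by
        gcongr
    _ = _ := by
        rw [ENNReal.ofReal_rpow_of_nonneg (by positivity) (by norm_num), ← Real.sqrt_eq_rpow,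
          Real.sqrt_mul hPC, Real.sqrt_sq hP]

/-! ### Moment bounds for increments of the sheet. -/

lemma hermiteKernel_eq_zero {d q : ℕ} {H t : Fin d → ℝ} (ht : ∃ i, t i = 0) :
    hermiteKernel q H t = 0 := by
  obtain ⟨i, hi⟩ := ht
  ext y
  rw [hermiteKernel_eq_prod]
  refine Finset.prod_eq_zero (Finset.mem_univ i) ?_
  simp [kernelPrimitive, hi]

lemma nonneg_piecewise {d : ℕ} {s t : Fin d → ℝ} (hs : 0 ≤ s) (ht : 0 ≤ t)
    (A : Finset (Fin d)) : 0 ≤ A.piecewise t s := by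
  intro i
  by_cases h : i ∈ A
  · simpa [h] using ht i
  · simpa [h] using hs i

/-- The Hermite sheet has a measurable version vanishing on the coordinate hyperplanes, whose
rectangular increments satisfy moment bounds of all even orders. -/
theorem IsHermiteSheet.exists_version {Ω : Type*} [MeasurableSpace Ω] {P : Measure Ω}
    [IsProbabilityMeasure P] {d q : ℕ} (hq : 1 ≤ q) {H : Fin d → ℝ}
    (hH : ∀ i, 1 / 2 < H i ∧ H i < 1) {c : ℝ} {W : (Fin d → ℝ) → Ω → ℝ}
    (hW : IsBrownianSheet W P) {Z : (Fin d → ℝ) → Ω → ℝ} (hZ : IsHermiteSheet W P q H c Z) :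
    ∃ Y : (Fin d → ℝ) → Ω → ℝ, (∀ t, Measurable (Y t)) ∧
      (∀ t, 0 ≤ t → ∀ᵐ ω ∂P, Y t ω = Z t ω) ∧
      (∀ t ω, (∃ i, t i = 0) → Y t ω = 0) ∧
      ∀ m : ℕ, m ≠ 0 → ∃ C : ℝ, 0 ≤ C ∧ ∀ s t : Fin d → ℝ, 0 ≤ s → 0 ≤ t →
        eLpNorm (fun ω => rectIncrement (fun u => Y u ω) s t) (2 * m : ℕ) P
          ≤ ENNReal.ofReal (C * ∏ i, |t i - s i| ^ H i) := by
  classical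
  choose! X hX hXZ using hZ
  have hXm : ∀ t, 0 ≤ t → AEStronglyMeasurable (fun ω => c * X t ω) P := fun t ht =>
    (hX t ht).memLp.aestronglyMeasurable.const_mul c
  have hX0 : ∀ t, 0 ≤ t → (∃ i, t i = 0) → ∀ᵐ ω ∂P, X t ω = 0 := by
    intro t ht h0
    have := hW.eLpNorm_sum_wiener_le (V := Unit) (fun _ => 1) (f := fun _ => hermiteKernel q H t)
      (X := fun _ => X t) (fun _ => hX t ht) (m := 1) one_ne_zero
    simp only [Finset.univ_unique, Finset.sum_singleton, one_mul, hermiteKernel_eq_zero h0,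
      Pi.zero_apply, eLpNorm_zero', mul_zero, nonpos_iff_eq_zero] at this
    exact (eLpNorm_eq_zero_iff (hX t ht).memLp.aestronglyMeasurable (by simp)).1 this
  -- Vanishing on the hyperplanes is imposed for every `ω`, not just almost surely, so that
  -- differences of values can later be written path by path as sums of rectangular increments.
  let Y : (Fin d → ℝ) → Ω → ℝ := fun t =>
    if h : 0 ≤ t ∧ ∀ i, t i ≠ 0 then (hXm t h.1).mk _ else 0
  have hYX : ∀ t, 0 ≤ t → ∀ᵐ ω ∂P, Y t ω = c * X t ω := by
    intro t ht
    by_cases h : ∀ i, t i ≠ 0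
    · have : Y t = (hXm t ht).mk _ := dif_pos ⟨ht, h⟩
      rw [this]
      exact (hXm t ht).ae_eq_mk.symm
    · have : Y t = 0 := dif_neg fun hh => h hh.2
      push Not at h
      filter_upwards [hX0 t ht h] with ω hω
      rw [this, hω]; simp
  refine ⟨Y, fun t => ?_, fun t ht => ?_, fun t ω h => ?_, fun m hm => ?_⟩
  · by_cases h : 0 ≤ t ∧ ∀ i, t i ≠ 0
    · have : Y t = (hXm t h.1).mk _ := dif_pos h
      rw [this]
      exact (hXm t h.1).stronglyMeasurable_mk.measurable
    · have : Y t = 0 := dif_neg h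
      rw [this]; exact measurable_const
  · filter_upwards [hYX t ht, hXZ t ht] with ω h1 h2
    rw [h1, h2]
  · obtain ⟨i, hi⟩ := h
    have : Y t = 0 := dif_neg fun hh => hh.2 i hi
    rw [this]; rfl
  · obtain ⟨C, hC0, hC⟩ := eLpNorm_rectIncrement_hermiteKernel_le hq hH
    refine ⟨|c| * (Real.sqrt (chaosConst q m) * C), by positivity, fun s t hs ht => ?_⟩
    have hpw := nonneg_piecewise hs ht
    have hae : (fun ω => rectIncrement (fun u => Y u ω) s t) =ᵐ[P]
        c • fun ω => ∑ A : Finset (Fin d), (-1 : ℝ) ^ (d - A.card) * X (A.piecewise t s) ω := by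
      have : ∀ᵐ ω ∂P, ∀ A : Finset (Fin d),
          Y (A.piecewise t s) ω = c * X (A.piecewise t s) ω :=
        ae_all_iff.2 fun A => hYX _ (hpw A)
      filter_upwards [this] with ω hω
      simp only [rectIncrement, hω, Pi.smul_apply, smul_eq_mul, Finset.mul_sum]
      exact Finset.sum_congr rfl fun A _ => by ring
    rw [eLpNorm_congr_ae hae, eLpNorm_const_smul]
    have h1 := hW.eLpNorm_sum_wiener_le (fun A : Finset (Fin d) => (-1 : ℝ) ^ (d - A.card))
      (fun A => hX _ (hpw A)) hm
    refine (mul_le_mul_right (h1.trans (mul_le_mul_right (hC s t hs ht) _)) _).trans ?_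
    rw [Real.enorm_eq_ofReal_abs, ← ENNReal.ofReal_mul (Real.sqrt_nonneg _),
      ← ENNReal.ofReal_mul (abs_nonneg _)]
    refine ENNReal.ofReal_le_ofReal (le_of_eq ?_)
    ring

/-! ### Chaining over dyadic points in one dimension. -/

/-- `[x, y]` is a dyadic cell contained in `[0, N]`. -/
def IsDyadicCell (N : ℕ) (x y : ℝ) : Prop :=
  ∃ n k : ℕ, k + 1 ≤ N * 2 ^ n ∧ x = k / 2 ^ n ∧ y = (k + 1 : ℕ) / 2 ^ n

/-- `x` and `y` are dyadic points of `[0, N]`. -/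
def IsDyadicPair (N : ℕ) (x y : ℝ) : Prop :=
  ∃ n k l : ℕ, k ≤ N * 2 ^ n ∧ l ≤ N * 2 ^ n ∧ x = k / 2 ^ n ∧ y = l / 2 ^ n

section OneDim

variable {δ : ℝ} {N : ℕ} {h : ℝ → ℝ} {M : ℝ}

lemma one_div_two_pow_rpow (δ : ℝ) (n : ℕ) :
    ((1 : ℝ) / 2 ^ n) ^ δ = ((1 / 2 : ℝ) ^ δ) ^ n := by
  rw [← one_div_pow, ← Real.rpow_natCast, ← Real.rpow_mul (by norm_num), mul_comm,
    Real.rpow_mul (by norm_num), Real.rpow_natCast]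

lemma abs_sub_le_of_dyadicCell (hM : ∀ x y, IsDyadicCell N x y → |h y - h x| ≤ M * |y - x| ^ δ)
    {n k : ℕ} (hk : k + 1 ≤ N * 2 ^ n) :
    |h ((k + 1 : ℕ) / 2 ^ n) - h (k / 2 ^ n)| ≤ M * ((1 / 2 : ℝ) ^ δ) ^ n := by
  have := hM _ _ ⟨n, k, hk, rfl, rfl⟩
  have e : |((k + 1 : ℕ) : ℝ) / 2 ^ n - k / 2 ^ n| = 1 / 2 ^ n := by
    rw [← sub_div]; push_cast
    rw [add_sub_cancel_left, abs_of_nonneg (by positivity)]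
  rwa [e, one_div_two_pow_rpow] at this

/-- The integer quotient `k / 2 ^ j` is the ancestor of `k` at level `n`. Halving `k` once crosses
at most one cell, and the costs of the successive halvings form a geometric sum. -/
lemma abs_sub_level_le (hM0 : 0 ≤ M) (hδ : 0 < δ)
    (hM : ∀ x y, IsDyadicCell N x y → |h y - h x| ≤ M * |y - x| ^ δ)
    (n j k : ℕ) (hk : k ≤ N * 2 ^ (n + j)) :
    |h (k / 2 ^ (n + j)) - h ((k / 2 ^ j : ℕ) / 2 ^ n)|
      ≤ M * ((1 / 2 : ℝ) ^ δ) ^ n * ∑ r ∈ Finset.range j, ((1 / 2 : ℝ) ^ δ) ^ r := by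
  have hρ0 : 0 ≤ (1 / 2 : ℝ) ^ δ := by positivity
  have hρ1 : (1 / 2 : ℝ) ^ δ ≤ 1 := Real.rpow_le_one (by norm_num) (by norm_num) hδ.le
  induction j generalizing k with
  | zero => simp
  | succ j ih =>
    have hk2 : k / 2 ≤ N * 2 ^ (n + j) := by
      have : N * 2 ^ (n + (j + 1)) = 2 * (N * 2 ^ (n + j)) := by ring
      omega
    have h1 := ih (k / 2) hk2
    have e1 : k / 2 / 2 ^ j = k / 2 ^ (j + 1) := by rw [Nat.div_div_eq_div_mul, pow_succ']
    rw [e1] at h1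
    have e2 : ((k / 2 : ℕ) : ℝ) / 2 ^ (n + j) = (2 * (k / 2) : ℕ) / 2 ^ (n + (j + 1)) := by
      push_cast
      rw [← add_assoc, pow_succ]
      field_simp
    have h2 : |h (k / 2 ^ (n + (j + 1))) - h ((k / 2 : ℕ) / 2 ^ (n + j))|
        ≤ M * ((1 / 2 : ℝ) ^ δ) ^ (n + j) := by
      rw [e2]
      rcases Nat.mod_two_eq_zero_or_one k with hk0 | hk0
      · have : 2 * (k / 2) = k := by omega
        rw [this]; simp only [sub_self, abs_zero]; positivity
      · have : k = 2 * (k / 2) + 1 := by omega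
        have h3 := abs_sub_le_of_dyadicCell hM (n := n + (j + 1)) (k := 2 * (k / 2))
          (by omega)
        rw [← this] at h3
        refine h3.trans (mul_le_mul_of_nonneg_left ?_ hM0)
        exact pow_le_pow_of_le_one hρ0 hρ1 (by omega)
    calc _ ≤ |h (k / 2 ^ (n + (j + 1))) - h ((k / 2 : ℕ) / 2 ^ (n + j))| +
          |h ((k / 2 : ℕ) / 2 ^ (n + j)) - h ((k / 2 ^ (j + 1) : ℕ) / 2 ^ n)| :=
          abs_sub_le _ _ _
      _ ≤ M * ((1 / 2 : ℝ) ^ δ) ^ (n + j) + _ := add_le_add h2 h1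
      _ = _ := by rw [Finset.sum_range_succ]; ring

lemma abs_sub_same_level_le (hM : ∀ x y, IsDyadicCell N x y → |h y - h x| ≤ M * |y - x| ^ δ)
    (n k j : ℕ) (hk : k + j ≤ N * 2 ^ n) :
    |h ((k + j : ℕ) / 2 ^ n) - h (k / 2 ^ n)| ≤ j * (M * ((1 / 2 : ℝ) ^ δ) ^ n) := by
  induction j with
  | zero => simp
  | succ j ih =>
    have h1 := ih (by omega)
    have h2 := abs_sub_le_of_dyadicCell hM (n := n) (k := k + j) (by omega)
    rw [add_assoc] at h2
    calc _ ≤ _ + _ := abs_sub_le _ (h ((k + j : ℕ) / 2 ^ n)) _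
      _ ≤ M * ((1 / 2 : ℝ) ^ δ) ^ n + j * (M * ((1 / 2 : ℝ) ^ δ) ^ n) := add_le_add h2 h1
      _ = _ := by push_cast; ring

/-- The constant in the passage from dyadic cells to pairs of dyadic points. -/
noncomputable def dyadicConst (N : ℕ) (δ : ℝ) : ℝ := N + 2 + 2 * (1 - (1 / 2 : ℝ) ^ δ)⁻¹

lemma half_rpow_lt_one (hδ : 0 < δ) : (1 / 2 : ℝ) ^ δ < 1 :=
  Real.rpow_lt_one (by norm_num) (by norm_num) hδ

lemma dyadicConst_nonneg (N : ℕ) (hδ : 0 < δ) : 0 ≤ dyadicConst N δ := by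
  have := half_rpow_lt_one hδ
  have : 0 < 1 - (1 / 2 : ℝ) ^ δ := by linarith
  unfold dyadicConst; positivity

/-- A bound on dyadic cells implies Hölder continuity at dyadic points. -/
theorem abs_sub_le_of_dyadicPair (hM0 : 0 ≤ M) (hδ : 0 < δ)
    (hM : ∀ x y, IsDyadicCell N x y → |h y - h x| ≤ M * |y - x| ^ δ) {x y : ℝ}
    (hxy : IsDyadicPair N x y) : |h y - h x| ≤ dyadicConst N δ * M * |y - x| ^ δ := by
  obtain ⟨m, k, l, hk, hl, rfl, rfl⟩ := hxy
  have hρ0 : 0 ≤ (1 / 2 : ℝ) ^ δ := by positivity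
  have hρ1 := half_rpow_lt_one hδ
  have hC := dyadicConst_nonneg N hδ
  wlog hkl : k ≤ l generalizing k l
  · rw [abs_sub_comm, abs_sub_comm (_ / _)]
    exact this l k hl hk (by omega)
  rcases hkl.eq_or_lt with rfl | hlt
  · simp only [sub_self, abs_zero]; positivity
  -- The level `n` is the one with `2^(-n)` comparable to `y - x`, where the ancestors are at most
  -- two cells apart. If that level would be negative, `n = 0` is used, and at most the `N` unit
  -- cells have to be crossed; `N + 2` covers both cases.
  obtain ⟨n, j, hm, hsteps, hlow⟩ : ∃ n j, m = n + j ∧ l / 2 ^ j ≤ k / 2 ^ j + (N + 2) ∧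
      2 ^ j ≤ l - k := by
    have h1 : 2 ^ (Nat.log 2 (l - k)) ≤ l - k := Nat.pow_log_le_self 2 (by omega)
    have h2 : l - k < 2 ^ (Nat.log 2 (l - k) + 1) := Nat.lt_pow_succ_log_self (by omega) _
    rcases le_total (Nat.log 2 (l - k)) m with hle | hle
    · refine ⟨m - Nat.log 2 (l - k), Nat.log 2 (l - k), by omega, ?_, h1⟩
      set e := Nat.log 2 (l - k)
      have : l ≤ k + 2 * 2 ^ e := by rw [pow_succ'] at h2; omega
      calc l / 2 ^ e ≤ (k + 2 * 2 ^ e) / 2 ^ e := Nat.div_le_div_right this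
        _ = k / 2 ^ e + 2 := Nat.add_mul_div_right _ _ (by positivity)
        _ ≤ _ := by omega
    · refine ⟨0, m, by omega, ?_, (Nat.pow_le_pow_right (by omega) hle).trans h1⟩
      have : l / 2 ^ m ≤ N := Nat.div_le_of_le_mul (by rw [mul_comm]; exact hl)
      exact le_add_left (this.trans (by omega))
  subst hm
  have b1 := abs_sub_level_le hM0 hδ hM n j k hk
  have b2 := abs_sub_level_le hM0 hδ hM n j l hl
  have hmono : k / 2 ^ j ≤ l / 2 ^ j := Nat.div_le_div_right hkl
  obtain ⟨r, hr⟩ := Nat.exists_eq_add_of_le hmono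
  have hrN : r ≤ N + 2 := by omega
  have hl2 : l / 2 ^ j ≤ N * 2 ^ n := Nat.div_le_of_le_mul (by
    calc l ≤ N * 2 ^ (n + j) := hl
      _ = _ := by ring)
  have b3 := abs_sub_same_level_le hM n (k / 2 ^ j) r (by omega)
  rw [← hr] at b3
  set ρ := (1 / 2 : ℝ) ^ δ with hρ
  have hgeom : ∑ r ∈ Finset.range j, ρ ^ r ≤ (1 - ρ)⁻¹ := by
    rw [← tsum_geometric_of_lt_one hρ0 hρ1]
    exact (summable_geometric_of_lt_one hρ0 hρ1).sum_le_tsum _ fun i _ => by positivity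
  have hMρ : 0 ≤ M * ρ ^ n := by positivity
  have hsum : |h (l / 2 ^ (n + j)) - h (k / 2 ^ (n + j))| ≤ dyadicConst N δ * M * ρ ^ n := by
    have t1 := abs_sub_le (h (l / 2 ^ (n + j))) (h ((l / 2 ^ j : ℕ) / 2 ^ n)) (h (k / 2 ^ (n + j)))
    have t2 := abs_sub_le (h ((l / 2 ^ j : ℕ) / 2 ^ n)) (h ((k / 2 ^ j : ℕ) / 2 ^ n))
      (h (k / 2 ^ (n + j)))
    rw [abs_sub_comm (h ((k / 2 ^ j : ℕ) / 2 ^ n))] at t2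
    have g := mul_le_mul_of_nonneg_left hgeom hMρ
    have hr' : (r : ℝ) * (M * ρ ^ n) ≤ (N + 2) * (M * ρ ^ n) := by
      gcongr; exact_mod_cast hrN
    have : dyadicConst N δ * M * ρ ^ n
        = (N + 2) * (M * ρ ^ n) + 2 * (M * ρ ^ n * (1 - ρ)⁻¹) := by
      unfold dyadicConst; ring
    rw [this]
    linarith
  refine hsum.trans (mul_le_mul_of_nonneg_left ?_ (by positivity))
  rw [hρ, ← one_div_two_pow_rpow]
  refine Real.rpow_le_rpow (by positivity) ?_ hδ.le
  rw [← sub_div, abs_of_nonneg (by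
    have : (k : ℝ) ≤ l := by exact_mod_cast hkl
    exact div_nonneg (by linarith) (by positivity)), pow_add, div_le_div_iff₀ (by positivity)
    (by positivity)]
  have : (2 : ℝ) ^ j ≤ l - k := by
    rw [← Nat.cast_sub hkl]; exact_mod_cast hlow
  calc 1 * ((2 : ℝ) ^ n * 2 ^ j) = 2 ^ n * 2 ^ j := one_mul _
    _ ≤ 2 ^ n * (l - k) := by gcongr
    _ = _ := by ring

end OneDim

/-! ### From dyadic cells to boxes with dyadic corners. -/

section Rect

variable {d : ℕ}

/-- The partial increment in all coordinates but `j`, as a function of the `j`-th coordinate. -/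
noncomputable def partialIncrement (X : (Fin d → ℝ) → ℝ) (s t : Fin d → ℝ) (j : Fin d) (x : ℝ) :
    ℝ :=
  ∑ A ∈ (Finset.univ.erase j).powerset,
    (-1 : ℝ) ^ (d - 1 - A.card) * X (Function.update (A.piecewise t s) j x)

/-- With the other sides frozen, a rectangular increment is an ordinary difference in coordinate
`j`, to which one-dimensional chaining applies. -/
lemma rectIncrement_update (X : (Fin d → ℝ) → ℝ) (s t : Fin d → ℝ) (j : Fin d) (x y : ℝ) :
    rectIncrement X (Function.update s j x) (Function.update t j y)
      = partialIncrement X s t j y - partialIncrement X s t j x := by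
  unfold rectIncrement partialIncrement
  rw [← Finset.powerset_univ, ← Finset.insert_erase (Finset.mem_univ j),
    Finset.sum_powerset_insert (Finset.notMem_erase j _), Finset.insert_erase (Finset.mem_univ j),
    add_comm, sub_eq_add_neg, ← Finset.sum_neg_distrib]
  have hA : ∀ A ∈ (Finset.univ.erase j).powerset, j ∉ A := fun A hA h =>
    Finset.notMem_erase j _ (Finset.mem_powerset.1 hA h)
  congr 1
  · refine Finset.sum_congr rfl fun A h => ?_
    have hj := hA A h
    rw [Finset.card_insert_of_notMem hj, Nat.sub_sub, Nat.add_comm 1]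
    congr 2
    ext i
    by_cases hi : i = j
    · subst hi; simp
    · by_cases hiA : i ∈ A <;> simp [hi, hiA]
  · refine Finset.sum_congr rfl fun A h => ?_
    have hj := hA A h
    have hcard : A.card ≤ d - 1 := by
      have := Finset.card_le_card (Finset.mem_powerset.1 h)
      rwa [Finset.card_erase_of_mem (Finset.mem_univ j), Finset.card_univ, Fintype.card_fin] at this
    have hd : 1 ≤ d := Nat.one_le_iff_ne_zero.2 fun h0 => by subst h0; exact j.elim0
    rw [show d - A.card = d - 1 - A.card + 1 by omega, pow_succ]
    have : A.piecewise (Function.update t j y) (Function.update s j x)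
        = Function.update (A.piecewise t s) j x := by
      ext i
      by_cases hi : i = j
      · subst hi; simp [hj]
      · by_cases hiA : i ∈ A <;> simp [hi, hiA]
    rw [this]; ring

/-- For functions vanishing on the coordinate hyperplanes, one-coordinate increments are
rectangular increments. -/
lemma rectIncrement_update_zero {X : (Fin d → ℝ) → ℝ} (hX : ∀ u, (∃ i, u i = 0) → X u = 0)
    (u : Fin d → ℝ) (j : Fin d) (x y : ℝ) :
    rectIncrement X (Function.update 0 j x) (Function.update u j y)
      = X (Function.update u j y) - X (Function.update u j x) := by
  have hp : ∀ z, partialIncrement X 0 u j z = X (Function.update u j z) := by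
    intro z
    unfold partialIncrement
    rw [Finset.sum_eq_single (Finset.univ.erase j)]
    · rw [Finset.card_erase_of_mem (Finset.mem_univ j), Finset.card_univ, Fintype.card_fin,
        Nat.sub_self, pow_zero, one_mul]
      congr 1
      ext i
      by_cases hi : i = j
      · subst hi; simp
      · simp [hi]
    · intro A hA hne
      have hsub := Finset.mem_powerset.1 hA
      obtain ⟨i, hi, hiA⟩ : ∃ i ∈ Finset.univ.erase j, i ∉ A := by
        by_contra hcon
        push Not at hcon
        exact hne (Finset.Subset.antisymm hsub hcon)
      have hij : i ≠ j := Finset.ne_of_mem_erase hi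
      rw [hX _ ⟨i, by simp [hij, hiA]⟩, mul_zero]
    · intro hcon
      exact absurd (Finset.mem_powerset.2 (Finset.Subset.refl _)) hcon
  rw [rectIncrement_update, hp, hp]

/-- The point that agrees with `t` in the first `j` coordinates and with `s` in the others. -/
def hybridPoint (s t : Fin d → ℝ) (j : ℕ) : Fin d → ℝ := fun i => if (i : ℕ) < j then t i else s i

/-- Telescopes along a path from `s` to `t` that changes one coordinate at a time; each step is the
increment over a box whose other sides start at `0`. -/
lemma sub_eq_sum_rectIncrement {X : (Fin d → ℝ) → ℝ} (hX : ∀ u, (∃ i, u i = 0) → X u = 0)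
    (s t : Fin d → ℝ) :
    X t - X s = ∑ i : Fin d, rectIncrement X (Function.update 0 i (s i))
      (Function.update (hybridPoint s t i) i (t i)) := by
  have h1 : ∀ i : Fin d, rectIncrement X (Function.update 0 i (s i))
      (Function.update (hybridPoint s t i) i (t i))
      = X (hybridPoint s t (i + 1)) - X (hybridPoint s t i) := by
    intro i
    rw [rectIncrement_update_zero hX]
    congr 2
    · ext l
      by_cases hl : l = i
      · subst hl; simp [hybridPoint]
      · have : (l : ℕ) ≠ i := fun e => hl (Fin.ext e)
        simp only [Function.update_of_ne hl, hybridPoint]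
        congr 1
        exact propext ⟨fun _ => by omega, fun _ => by omega⟩
    · ext l
      by_cases hl : l = i
      · subst hl; simp [hybridPoint]
      · simp [Function.update_of_ne hl]
  simp only [h1]
  rw [Fin.sum_univ_eq_sum_range (fun i => X (hybridPoint s t (i + 1)) - X (hybridPoint s t i)),
    Finset.sum_range_sub (fun i => X (hybridPoint s t i))]
  congr 2
  ext i; simp [hybridPoint]

/-- A bound on dyadic cells implies a rectangular Hölder bound at dyadic points. -/
theorem abs_rectIncrement_le_of_dyadicPair {N : ℕ} {δ : Fin d → ℝ} (hδ : ∀ i, 0 < δ i)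
    {X : (Fin d → ℝ) → ℝ} {M : ℝ} (hM0 : 0 ≤ M)
    (hM : ∀ s t : Fin d → ℝ, (∀ i, IsDyadicCell N (s i) (t i)) →
      |rectIncrement X s t| ≤ M * ∏ i, |t i - s i| ^ δ i)
    {s t : Fin d → ℝ} (hst : ∀ i, IsDyadicPair N (s i) (t i)) :
    |rectIncrement X s t| ≤ (∏ i, dyadicConst N (δ i)) * M * ∏ i, |t i - s i| ^ δ i := by
  -- `J` holds the coordinates already freed from being single cells. Freeing one more applies the
  -- one-dimensional chaining to the partial increment, the other factors being absorbed in its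
  -- constant.
  have key : ∀ J : Finset (Fin d), ∀ s t : Fin d → ℝ, (∀ i ∈ J, IsDyadicPair N (s i) (t i)) →
      (∀ i ∉ J, IsDyadicCell N (s i) (t i)) →
      |rectIncrement X s t| ≤ (∏ i ∈ J, dyadicConst N (δ i)) * M * ∏ i, |t i - s i| ^ δ i := by
    intro J
    induction J using Finset.induction_on with
    | empty =>
      intro s t _ h
      simpa using hM s t fun i => h i (Finset.notMem_empty i)
    | insert j J hj ih =>
      intro s t h1 h2
      set R := ∏ i ∈ Finset.univ.erase j, |t i - s i| ^ δ i with hR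
      have hR0 : 0 ≤ R := Finset.prod_nonneg fun i _ => Real.rpow_nonneg (abs_nonneg _) _
      have hJ0 : 0 ≤ ∏ i ∈ J, dyadicConst N (δ i) :=
        Finset.prod_nonneg fun i _ => dyadicConst_nonneg N (hδ i)
      have hsplit : ∀ x y : ℝ, ∏ i, |Function.update t j y i - Function.update s j x i| ^ δ i
          = |y - x| ^ δ j * R := by
        intro x y
        rw [← Finset.mul_prod_erase _ _ (Finset.mem_univ j)]
        simp only [Function.update_self]
        congr 1
        refine Finset.prod_congr rfl fun i hi => ?_
        have := Finset.ne_of_mem_erase hi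
        simp [this]
      have hcell : ∀ x y, IsDyadicCell N x y →
          |partialIncrement X s t j y - partialIncrement X s t j x|
            ≤ ((∏ i ∈ J, dyadicConst N (δ i)) * M * R) * |y - x| ^ δ j := by
        intro x y hxy
        rw [← rectIncrement_update]
        refine (ih _ _ (fun i hi => ?_) (fun i hi => ?_)).trans_eq ?_
        · have hij : i ≠ j := fun e => hj (e ▸ hi)
          simpa [hij] using h1 i (Finset.mem_insert_of_mem hi)
        · by_cases hij : i = j
          · subst hij; simpa using hxy
          · simpa [hij] using h2 i (by simp [hij, hi])
        · rw [hsplit]; ring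
      have := abs_sub_le_of_dyadicPair (by positivity) (hδ j) hcell
        (h1 j (Finset.mem_insert_self j J))
      rw [← rectIncrement_update, Function.update_eq_self, Function.update_eq_self] at this
      refine this.trans_eq ?_
      have hs := hsplit (s j) (t j)
      rw [Function.update_eq_self, Function.update_eq_self] at hs
      rw [hs, Finset.prod_insert hj]; ring
  exact key Finset.univ s t (fun i _ => hst i) fun i hi => absurd (Finset.mem_univ i) hi

end Rect

/-! ### Extension from dyadic points to the orthant. -/

section Extension

variable {d : ℕ}

/-- The dyadic approximation of level `n` from below. -/
noncomputable def dyadicFloor (n : ℕ) (t : Fin d → ℝ) : Fin d → ℝ :=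
  fun i => (⌊t i * 2 ^ n⌋₊ : ℝ) / 2 ^ n

lemma dyadicFloor_nonneg (n : ℕ) (t : Fin d → ℝ) : 0 ≤ dyadicFloor n t := fun _ => by
  simp only [dyadicFloor, Pi.zero_apply]; positivity

lemma dyadicFloor_le (n : ℕ) {t : Fin d → ℝ} (ht : 0 ≤ t) (i : Fin d) :
    dyadicFloor n t i ≤ t i := by
  have := Nat.floor_le (a := t i * 2 ^ n) (mul_nonneg (ht i) (by positivity))
  exact div_le_of_le_mul₀ (by positivity) (ht i) this

lemma tendsto_dyadicFloor {t : Fin d → ℝ} (ht : 0 ≤ t) (i : Fin d) :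
    Tendsto (fun n => dyadicFloor n t i) atTop (𝓝 (t i)) :=
  (tendsto_nat_floor_mul_div_atTop (ht i)).comp
    (tendsto_pow_atTop_atTop_of_one_lt (one_lt_two : (1 : ℝ) < 2))

lemma isDyadicPair_dyadicFloor {N : ℕ} {s t : Fin d → ℝ} (hs : ∀ i, s i ≤ N) (ht : ∀ i, t i ≤ N)
    (m n : ℕ) (i : Fin d) : IsDyadicPair N (dyadicFloor m s i) (dyadicFloor n t i) := by
  have hle : ∀ (m : ℕ) {u : ℝ}, u ≤ N → ⌊u * 2 ^ m⌋₊ ≤ N * 2 ^ m := fun m u hu =>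
    Nat.floor_le_of_le (by push_cast; gcongr)
  have key : ∀ (m p : ℕ) (u : ℝ), m ≤ p → u ≤ N → ∃ k : ℕ, k ≤ N * 2 ^ p ∧
      (⌊u * 2 ^ m⌋₊ : ℝ) / 2 ^ m = k / 2 ^ p := by
    intro m p u hmp hu
    obtain ⟨e, rfl⟩ := Nat.exists_eq_add_of_le hmp
    refine ⟨⌊u * 2 ^ m⌋₊ * 2 ^ e, ?_, ?_⟩
    · rw [pow_add, ← mul_assoc]; exact Nat.mul_le_mul_right _ (hle m hu)
    · push_cast; rw [pow_add]; field_simp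
  obtain ⟨k, hk, ek⟩ := key m (max m n) (s i) (le_max_left _ _) (hs i)
  obtain ⟨l, hl, el⟩ := key n (max m n) (t i) (le_max_right _ _) (ht i)
  exact ⟨max m n, k, l, hk, hl, ek, el⟩

lemma IsDyadicPair.symm {N : ℕ} {x y : ℝ} (h : IsDyadicPair N x y) : IsDyadicPair N y x := by
  obtain ⟨n, k, l, hk, hl, rfl, rfl⟩ := h
  exact ⟨n, l, k, hl, hk, rfl, rfl⟩

lemma IsDyadicPair.zero_left {N : ℕ} {x y : ℝ} (h : IsDyadicPair N x y) : IsDyadicPair N 0 y := by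
  obtain ⟨n, k, l, hk, hl, rfl, rfl⟩ := h
  exact ⟨n, 0, l, Nat.zero_le _, hl, by simp, rfl⟩

lemma IsDyadicPair.mem_Icc {N : ℕ} {x y : ℝ} (h : IsDyadicPair N x y) : 0 ≤ y ∧ y ≤ N := by
  obtain ⟨n, k, l, hk, hl, rfl, rfl⟩ := h
  refine ⟨by positivity, div_le_of_le_mul₀ (by positivity) (by positivity) ?_⟩
  exact_mod_cast hl

lemma prod_abs_hybridPoint_le {δ : Fin d → ℝ} (hδ : ∀ i, 0 ≤ δ i) {N : ℝ} {s t : Fin d → ℝ}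
    (hs : ∀ i, 0 ≤ s i ∧ s i ≤ N) (ht : ∀ i, 0 ≤ t i ∧ t i ≤ N) (i : Fin d) :
    ∏ l, |Function.update (hybridPoint s t i) i (t i) l -
        Function.update (0 : Fin d → ℝ) i (s i) l| ^ δ l
      ≤ (∏ l ∈ Finset.univ.erase i, N ^ δ l) * |t i - s i| ^ δ i := by
  rw [← Finset.mul_prod_erase _ _ (Finset.mem_univ i), mul_comm]
  simp only [Function.update_self]
  refine mul_le_mul_of_nonneg_right ?_ (Real.rpow_nonneg (abs_nonneg _) _)
  refine Finset.prod_le_prod (fun l _ => Real.rpow_nonneg (abs_nonneg _) _) fun l hl => ?_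
  have hli := Finset.ne_of_mem_erase hl
  simp only [Function.update_of_ne hli, Pi.zero_apply, sub_zero]
  refine Real.rpow_le_rpow (abs_nonneg _) ?_ (hδ l)
  unfold hybridPoint
  split_ifs
  · rw [abs_of_nonneg (ht l).1]; exact (ht l).2
  · rw [abs_of_nonneg (hs l).1]; exact (hs l).2

/-- A bound on dyadic cells implies a modulus of continuity at dyadic points. -/
lemma abs_sub_le_sum_of_dyadicPair {N : ℕ} {δ : Fin d → ℝ} (hδ : ∀ i, 0 < δ i)
    {X : (Fin d → ℝ) → ℝ} (hX : ∀ u, (∃ i, u i = 0) → X u = 0) {M : ℝ} (hM0 : 0 ≤ M)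
    (hM : ∀ s t : Fin d → ℝ, (∀ i, IsDyadicCell N (s i) (t i)) →
      |rectIncrement X s t| ≤ M * ∏ i, |t i - s i| ^ δ i) :
    ∃ C : Fin d → ℝ, ∀ s t : Fin d → ℝ, (∀ i, IsDyadicPair N (s i) (t i)) →
      |X t - X s| ≤ ∑ i, C i * |t i - s i| ^ δ i := by
  have hK : 0 ≤ (∏ i, dyadicConst N (δ i)) * M :=
    mul_nonneg (Finset.prod_nonneg fun i _ => dyadicConst_nonneg N (hδ i)) hM0
  refine ⟨fun i => (∏ i, dyadicConst N (δ i)) * M * ∏ l ∈ Finset.univ.erase i, (N : ℝ) ^ δ l,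
    fun s t hst => ?_⟩
  rw [sub_eq_sum_rectIncrement hX s t]
  refine (Finset.abs_sum_le_sum_abs _ _).trans (Finset.sum_le_sum fun i _ => ?_)
  refine (abs_rectIncrement_le_of_dyadicPair hδ hM0 hM fun l => ?_).trans ?_
  · by_cases hl : l = i
    · subst hl; simpa using hst l
    · simp only [Function.update_of_ne hl, Pi.zero_apply, hybridPoint]
      split_ifs
      · exact (hst l).zero_left
      · exact (hst l).symm.zero_left
  · rw [mul_assoc _ _ (|t i - s i| ^ δ i)]
    exact mul_le_mul_of_nonneg_left (prod_abs_hybridPoint_le (fun i => (hδ i).le)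
      (fun l => (hst l).symm.mem_Icc) (fun l => (hst l).mem_Icc) i) hK

lemma dyadicFloor_piecewise (n : ℕ) (s t : Fin d → ℝ) (A : Finset (Fin d)) :
    A.piecewise (dyadicFloor n t) (dyadicFloor n s) = dyadicFloor n (A.piecewise t s) := by
  ext i
  by_cases h : i ∈ A <;> simp [h, dyadicFloor]

/-- A function satisfying Hölder bounds on dyadic cells extends from the dyadic points to a
continuous function satisfying rectangular Hölder bounds. -/
theorem exists_continuous_extension {H : Fin d → ℝ} (hH : ∀ i, 0 < H i) {X : (Fin d → ℝ) → ℝ}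
    (hX : ∀ u, (∃ i, u i = 0) → X u = 0)
    (hgood : ∀ δ : Fin d → ℝ, (∀ i, 0 < δ i ∧ δ i < H i) → ∀ N : ℕ, ∃ M : ℝ, 0 ≤ M ∧
      ∀ s t : Fin d → ℝ, (∀ i, IsDyadicCell N (s i) (t i)) →
        |rectIncrement X s t| ≤ M * ∏ i, |t i - s i| ^ δ i) :
    ∃ X' : (Fin d → ℝ) → ℝ,
      (∀ t, 0 ≤ t → Tendsto (fun n => X (dyadicFloor n t)) atTop (𝓝 (X' t))) ∧
      ContinuousOn X' {t | 0 ≤ t} ∧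
      ∀ δ : Fin d → ℝ, (∀ i, 0 ≤ δ i ∧ δ i < H i) → ∀ N : ℝ, 0 < N → ∃ C : ℝ, 0 < C ∧
          ∀ s t : Fin d → ℝ, (∀ i, 0 ≤ s i ∧ s i ≤ N) → (∀ i, 0 ≤ t i ∧ t i ≤ N) →
            |rectIncrement X' s t| ≤ C * ∏ i, |t i - s i| ^ δ i := by
  -- Any admissible exponents give existence of limits and continuity; `H i / 2` is one choice.
  have hmod : ∀ N : ℕ, ∃ C : Fin d → ℝ, ∀ s t : Fin d → ℝ,
      (∀ i, IsDyadicPair N (s i) (t i)) → |X t - X s| ≤ ∑ i, C i * |t i - s i| ^ (H i / 2) := by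
    intro N
    obtain ⟨M, hM0, hM⟩ := hgood (fun i => H i / 2)
      (fun i => ⟨half_pos (hH i), half_lt_self (hH i)⟩) N
    exact abs_sub_le_sum_of_dyadicPair (fun i => half_pos (hH i)) hX hM0 hM
  choose C hC using hmod
  have hbd : ∀ t : Fin d → ℝ, ∃ N : ℕ, ∀ i, t i < N := by
    intro t
    obtain ⟨N, hN⟩ := exists_nat_gt (∑ i, |t i|)
    exact ⟨N, fun i => ((le_abs_self _).trans (Finset.single_le_sum (f := fun i => |t i|)
      (fun _ _ => abs_nonneg _) (Finset.mem_univ i))).trans_lt hN⟩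
  have hlim : ∀ t, 0 ≤ t → ∃ x, Tendsto (fun n => X (dyadicFloor n t)) atTop (𝓝 x) := by
    intro t ht
    obtain ⟨N, hN⟩ := hbd t
    refine cauchySeq_tendsto_of_complete (cauchySeq_iff_tendsto_dist_atTop_0.2 ?_)
    have hz : Tendsto (fun p : ℕ × ℕ => ∑ i, C N i *
        |dyadicFloor p.1 t i - dyadicFloor p.2 t i| ^ (H i / 2)) atTop (𝓝 0) := by
      have : Tendsto (fun p : ℕ × ℕ => ∑ i, C N i *
          |dyadicFloor p.1 t i - dyadicFloor p.2 t i| ^ (H i / 2)) atTop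
          (𝓝 (∑ i, C N i * |t i - t i| ^ (H i / 2))) := by
        rw [← prod_atTop_atTop_eq]
        refine tendsto_finsetSum _ fun i _ => ?_
        refine Tendsto.const_mul _ (Tendsto.rpow_const ?_ (Or.inr (half_pos (hH i)).le))
        exact (((tendsto_dyadicFloor ht i).comp tendsto_fst).sub
          ((tendsto_dyadicFloor ht i).comp tendsto_snd)).abs
      simpa [Real.zero_rpow (half_pos (hH _)).ne', (hH _).ne'] using this
    refine squeeze_zero (fun _ => dist_nonneg) (fun p => ?_) hz
    rw [Real.dist_eq]
    exact hC N _ _ (isDyadicPair_dyadicFloor (fun i => (hN i).le) (fun i => (hN i).le) _ _)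
  choose! X' hX' using hlim
  refine ⟨X', hX', ?_, ?_⟩
  · have hmod' : ∀ (N : ℕ) (s t : Fin d → ℝ), 0 ≤ s → 0 ≤ t → (∀ i, s i ≤ N) → (∀ i, t i ≤ N) →
        |X' t - X' s| ≤ ∑ i, C N i * |t i - s i| ^ (H i / 2) := by
      intro N s t hs ht hsN htN
      refine le_of_tendsto_of_tendsto' ((hX' t ht).sub (hX' s hs)).abs
        (f := fun n => |X (dyadicFloor n t) - X (dyadicFloor n s)|)
        (g := fun n => ∑ i, C N i * |dyadicFloor n t i - dyadicFloor n s i| ^ (H i / 2)) ?_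
        fun n => hC N _ _ (isDyadicPair_dyadicFloor hsN htN n n)
      refine tendsto_finsetSum _ fun i _ => ?_
      exact Tendsto.const_mul _ (Tendsto.rpow_const
        ((tendsto_dyadicFloor ht i).sub (tendsto_dyadicFloor hs i)).abs
        (Or.inr (half_pos (hH i)).le))
    intro t ht
    obtain ⟨N, hN⟩ := hbd t
    rw [ContinuousWithinAt, tendsto_iff_dist_tendsto_zero]
    have hz : Tendsto (fun u : Fin d → ℝ => ∑ i, C N i * |u i - t i| ^ (H i / 2))
        (𝓝[{t | 0 ≤ t}] t) (𝓝 0) := by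
      have : Tendsto (fun u : Fin d → ℝ => ∑ i, C N i * |u i - t i| ^ (H i / 2))
          (𝓝 t) (𝓝 (∑ i, C N i * |t i - t i| ^ (H i / 2))) := by
        refine tendsto_finsetSum _ fun i _ => ?_
        refine Tendsto.const_mul _ (Tendsto.rpow_const ?_ (Or.inr (half_pos (hH i)).le))
        exact (((continuous_apply i).tendsto t).sub tendsto_const_nhds).abs
      refine Tendsto.mono_left ?_ nhdsWithin_le_nhds
      simpa [(hH _).ne'] using this
    refine squeeze_zero' (Eventually.of_forall fun _ => dist_nonneg) ?_ hz
    have hev : ∀ᶠ u : Fin d → ℝ in 𝓝 t, ∀ i, u i < N := by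
      rw [eventually_all]
      exact fun i => ((continuous_apply i).tendsto t).eventually_lt_const (hN i)
    filter_upwards [self_mem_nhdsWithin, nhdsWithin_le_nhds hev] with u hu huN
    rw [Real.dist_eq]
    exact hmod' N t u ht hu (fun i => (hN i).le) fun i => (huN i).le
  · intro δ hδ N hN
    -- Chaining needs positive exponents while `δ i = 0` is allowed, so the bound is proved with `δ'
    -- ≥ δ`; on `[0, N]` the surplus powers cost `N ^ (δ' i - δ i)`.
    set δ' : Fin d → ℝ := fun i => max (δ i) (H i / 2) with hδ'
    have hδ'0 : ∀ i, 0 < δ' i := fun i => lt_max_of_lt_right (half_pos (hH i))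
    obtain ⟨N', hN'⟩ := exists_nat_ge N
    obtain ⟨M, hM0, hM⟩ := hgood δ'
      (fun i => ⟨hδ'0 i, max_lt (hδ i).2 (half_lt_self (hH i))⟩) N'
    set K := (∏ i, dyadicConst N' (δ' i)) * M with hK
    have hK0 : 0 ≤ K :=
      mul_nonneg (Finset.prod_nonneg fun i _ => dyadicConst_nonneg N' (hδ'0 i)) hM0
    have hB0 : 0 ≤ ∏ i, N ^ (δ' i - δ i) := Finset.prod_nonneg fun i _ => by positivity
    refine ⟨K * ∏ i, N ^ (δ' i - δ i) + 1, by positivity, fun s t hs ht => ?_⟩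
    have hs0 : 0 ≤ s := fun i => (hs i).1
    have ht0 : 0 ≤ t := fun i => (ht i).1
    have h1 : |rectIncrement X' s t| ≤ K * ∏ i, |t i - s i| ^ δ' i := by
      refine le_of_tendsto_of_tendsto'
        (f := fun n => |rectIncrement X (dyadicFloor n s) (dyadicFloor n t)|)
        (g := fun n => K * ∏ i, |dyadicFloor n t i - dyadicFloor n s i| ^ δ' i) (b := atTop)
        ?_ ?_ fun n => ?_
      · refine Tendsto.abs ?_
        unfold rectIncrement
        refine tendsto_finsetSum _ fun A _ => Tendsto.const_mul _ ?_
        simp only [dyadicFloor_piecewise]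
        refine hX' _ fun i => ?_
        by_cases h : i ∈ A
        · simpa [h] using ht0 i
        · simpa [h] using hs0 i
      · refine Tendsto.const_mul _ (tendsto_finsetProd _ fun i _ => ?_)
        exact Tendsto.rpow_const
          ((tendsto_dyadicFloor ht0 i).sub (tendsto_dyadicFloor hs0 i)).abs
          (Or.inr (hδ'0 i).le)
      · exact abs_rectIncrement_le_of_dyadicPair hδ'0 hM0 hM
          (isDyadicPair_dyadicFloor (fun i => (hs i).2.trans hN') (fun i => (ht i).2.trans hN') n n)
    have h2 : ∏ i, |t i - s i| ^ δ' i ≤ (∏ i, N ^ (δ' i - δ i)) * ∏ i, |t i - s i| ^ δ i := by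
      rw [← Finset.prod_mul_distrib]
      refine Finset.prod_le_prod (fun i _ => Real.rpow_nonneg (abs_nonneg _) _) fun i _ => ?_
      rcases (abs_nonneg (t i - s i)).eq_or_lt with h0 | h0
      · rw [← h0, Real.zero_rpow (hδ'0 i).ne']
        positivity
      · calc |t i - s i| ^ δ' i = |t i - s i| ^ (δ' i - δ i) * |t i - s i| ^ δ i := by
              rw [← Real.rpow_add h0, sub_add_cancel]
          _ ≤ _ := by
            refine mul_le_mul_of_nonneg_right ?_ (by positivity)
            refine Real.rpow_le_rpow h0.le ?_ (sub_nonneg.2 (le_max_left _ _))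
            rw [abs_le]
            constructor <;> linarith [(hs i).1, (hs i).2, (ht i).1, (ht i).2]
    have hP : 0 ≤ ∏ i, |t i - s i| ^ δ i :=
      Finset.prod_nonneg fun i _ => Real.rpow_nonneg (abs_nonneg _) _
    calc |rectIncrement X' s t| ≤ K * ((∏ i, N ^ (δ' i - δ i)) * ∏ i, |t i - s i| ^ δ i) :=
          h1.trans (mul_le_mul_of_nonneg_left h2 hK0)
      _ ≤ _ := by linarith

end Extension

/-! ### A Kolmogorov criterion for rectangular increments. -/

lemma tsum_pi_prod_le {d : ℕ} (f : Fin d → ℕ → ℝ≥0∞) :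
    ∑' n : Fin d → ℕ, ∏ i, f i (n i) ≤ ∏ i, ∑' k, f i k := by
  classical
  rw [ENNReal.tsum_eq_iSup_sum]
  refine iSup_le fun T => ?_
  obtain ⟨B, hB⟩ : ∃ B : ℕ, ∀ n ∈ T, ∀ i, n i < B := by
    refine ⟨∑ n ∈ T, ∑ i, n i + 1, fun n hn i => Nat.lt_succ_of_le ?_⟩
    exact (Finset.single_le_sum (f := n) (fun _ _ => Nat.zero_le _) (Finset.mem_univ i)).trans
      (Finset.single_le_sum (f := fun n : Fin d → ℕ => ∑ i, n i) (fun _ _ => Nat.zero_le _) hn)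
  calc ∑ n ∈ T, ∏ i, f i (n i)
      ≤ ∑ n ∈ Fintype.piFinset fun _ => Finset.range B, ∏ i, f i (n i) :=
        Finset.sum_le_sum_of_subset fun n hn =>
          Fintype.mem_piFinset.2 fun i => Finset.mem_range.2 (hB n hn i)
    _ = ∏ i, ∑ k ∈ Finset.range B, f i k := (Finset.prod_univ_sum _ _).symm
    _ ≤ _ := Finset.prod_le_prod' fun i _ => ENNReal.sum_le_tsum _

lemma lintegral_enorm_pow_eq_eLpNorm_pow {Ω : Type*} [MeasurableSpace Ω] {P : Measure Ω}
    (f : Ω → ℝ) {p : ℕ} (hp : p ≠ 0) : ∫⁻ ω, ‖f ω‖ₑ ^ p ∂P = eLpNorm f p P ^ p := by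
  have := eLpNorm_nnreal_pow_eq_lintegral (f := f) (μ := P) (p := (p : NNReal))
    (by exact_mod_cast hp)
  simpa only [NNReal.coe_natCast, ENNReal.rpow_natCast, ENNReal.coe_natCast] using this.symm

section Modification

variable {Ω : Type*} [MeasurableSpace Ω] {P : Measure Ω} {d : ℕ}

lemma measurable_rectIncrement {Y : (Fin d → ℝ) → Ω → ℝ} (hY : ∀ t, Measurable (Y t))
    (s t : Fin d → ℝ) : Measurable fun ω => rectIncrement (fun u => Y u ω) s t :=
  Finset.measurable_sum _ fun _ _ => measurable_const.mul (hY _)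

/-- Almost sure Hölder bounds on the dyadic cells of `[0, N]^d` from moment bounds. -/
lemma ae_exists_dyadicCell_bound {Y : (Fin d → ℝ) → Ω → ℝ}
    (hY : ∀ t, Measurable (Y t)) {H δ : Fin d → ℝ} {m : ℕ} (hm : m ≠ 0)
    (hδ : ∀ i, 1 < (2 * m : ℕ) * (H i - δ i)) {C : ℝ} (hC0 : 0 ≤ C)
    (hC : ∀ s t : Fin d → ℝ, 0 ≤ s → 0 ≤ t →
      eLpNorm (fun ω => rectIncrement (fun u => Y u ω) s t) (2 * m : ℕ) P
        ≤ ENNReal.ofReal (C * ∏ i, |t i - s i| ^ H i)) (N : ℕ) :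
    ∀ᵐ ω ∂P, ∃ M : ℝ, 0 ≤ M ∧ ∀ s t : Fin d → ℝ, (∀ i, IsDyadicCell N (s i) (t i)) →
      |rectIncrement (fun u => Y u ω) s t| ≤ M * ∏ i, |t i - s i| ^ δ i := by
  have h2m : 2 * m ≠ 0 := by omega
  let lo : (Fin d → ℕ) → (Fin d → ℕ) → Fin d → ℝ := fun n k i => k i / 2 ^ n i
  let hi : (Fin d → ℕ) → (Fin d → ℕ) → Fin d → ℝ := fun n k i => (k i + 1 : ℕ) / 2 ^ n i
  have hlen : ∀ n k i, |hi n k i - lo n k i| = 1 / 2 ^ n i := by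
    intro n k i
    simp only [hi, lo]
    rw [← sub_div]; push_cast
    rw [add_sub_cancel_left, abs_of_nonneg (by positivity)]
  let w : (Fin d → ℕ) → ℝ := fun n => ∏ i, ((1 : ℝ) / 2 ^ n i) ^ δ i
  have hw : ∀ n, 0 < w n := fun n => Finset.prod_pos fun i _ => by positivity
  let T : (Fin d → ℕ) → (Fin d → ℕ) → Ω → ℝ≥0∞ := fun n k ω =>
    ‖rectIncrement (fun u => Y u ω) (lo n k) (hi n k)‖ₑ ^ (2 * m) *
      ENNReal.ofReal (w n)⁻¹ ^ (2 * m)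
  have hTm : ∀ n k, Measurable (T n k) := fun n k =>
    ((measurable_rectIncrement hY _ _).enorm.pow_const _).mul_const _
  -- The common ratio of the series over levels in coordinate `i`: the `2` comes from the `N * 2 ^
  -- n` cells of level `n`, the rest from the moment bound divided by the weight. It is below `1`
  -- because `2m(H i - δ i) > 1`.
  let r : Fin d → ℝ≥0∞ := fun i => 2 * ENNReal.ofReal ((1 / 2 : ℝ) ^ (H i - δ i)) ^ (2 * m)
  have hr : ∀ i, r i < 1 := by
    intro i
    have h1 : ((1 / 2 : ℝ) ^ (H i - δ i)) ^ (2 * m) < 1 / 2 := by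
      rw [← Real.rpow_natCast, ← Real.rpow_mul (by norm_num), mul_comm]
      calc (1 / 2 : ℝ) ^ (((2 * m : ℕ) : ℝ) * (H i - δ i)) < (1 / 2 : ℝ) ^ (1 : ℝ) :=
            Real.rpow_lt_rpow_of_exponent_gt (by norm_num) (by norm_num) (hδ i)
        _ = 1 / 2 := Real.rpow_one _
    simp only [r]
    rw [← ENNReal.ofReal_pow (by positivity), ← ENNReal.ofReal_ofNat,
      ← ENNReal.ofReal_mul (by norm_num), ENNReal.ofReal_lt_one]
    linarith
  have hTint : ∀ n k, ∫⁻ ω, T n k ω ∂P ≤ ENNReal.ofReal C ^ (2 * m) *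
      ∏ i, (ENNReal.ofReal ((1 / 2 : ℝ) ^ (H i - δ i)) ^ (2 * m)) ^ n i := by
    intro n k
    simp only [T]
    rw [lintegral_mul_const _ ((measurable_rectIncrement hY _ _).enorm.pow_const _),
      lintegral_enorm_pow_eq_eLpNorm_pow _ h2m, ← mul_pow]
    have hlo0 : 0 ≤ lo n k := fun i => by simp only [lo, Pi.zero_apply]; positivity
    have hhi0 : 0 ≤ hi n k := fun i => by simp only [hi, Pi.zero_apply]; positivity
    have h1 := hC _ _ hlo0 hhi0
    simp only [hlen] at h1
    have hprod : (∏ i, ((1 : ℝ) / 2 ^ n i) ^ H i) * (w n)⁻¹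
        = ∏ i, ((1 / 2 : ℝ) ^ (H i - δ i)) ^ n i := by
      simp only [w]
      rw [← Finset.prod_inv_distrib, ← Finset.prod_mul_distrib]
      refine Finset.prod_congr rfl fun i _ => ?_
      rw [← one_div_two_pow_rpow, Real.rpow_sub (by positivity)]
      exact (div_eq_mul_inv _ _).symm
    calc _ ≤ (ENNReal.ofReal (C * ∏ i, ((1 : ℝ) / 2 ^ n i) ^ H i) *
            ENNReal.ofReal (w n)⁻¹) ^ (2 * m) := by gcongr
      _ = (ENNReal.ofReal C * ∏ i, ENNReal.ofReal ((1 / 2 : ℝ) ^ (H i - δ i)) ^ n i) ^ (2 * m) := by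
          rw [← ENNReal.ofReal_mul (mul_nonneg hC0 (Finset.prod_nonneg fun i _ => by positivity)),
            mul_assoc, hprod, ENNReal.ofReal_mul hC0,
            ENNReal.ofReal_prod_of_nonneg fun i _ => by positivity]
          simp only [ENNReal.ofReal_pow (Real.rpow_nonneg (by norm_num : (0 : ℝ) ≤ 1 / 2) _)]
      _ = _ := by
          rw [mul_pow, ← Finset.prod_pow]
          congr 1
          exact Finset.prod_congr rfl fun i _ => by rw [← pow_mul, ← pow_mul, mul_comm]
  let K : (Fin d → ℕ) → Finset (Fin d → ℕ) := fun n =>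
    Fintype.piFinset fun i => Finset.range (N * 2 ^ n i)
  have hSint : ∫⁻ ω, ∑' n, ∑ k ∈ K n, T n k ω ∂P ≠ ∞ := by
    rw [lintegral_tsum fun n => (Finset.measurable_sum _ fun k _ => hTm n k).aemeasurable]
    have hle : ∀ n, ∫⁻ ω, ∑ k ∈ K n, T n k ω ∂P
        ≤ ENNReal.ofReal C ^ (2 * m) * ∏ i, ((N : ℝ≥0∞) * r i ^ n i) := by
      intro n
      rw [lintegral_finsetSum _ fun k _ => hTm n k]
      refine (Finset.sum_le_sum fun k _ => hTint n k).trans_eq ?_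
      rw [Finset.sum_const, nsmul_eq_mul, Fintype.card_piFinset]
      simp only [Finset.card_range, r, mul_pow]
      push_cast
      simp only [Finset.prod_mul_distrib]
      ring
    refine ne_top_of_le_ne_top ?_ (ENNReal.tsum_le_tsum hle)
    rw [ENNReal.tsum_mul_left]
    refine ENNReal.mul_ne_top (ENNReal.pow_ne_top ENNReal.ofReal_ne_top) ?_
    refine ne_top_of_le_ne_top ?_ (tsum_pi_prod_le fun i k => (N : ℝ≥0∞) * r i ^ k)
    refine ENNReal.prod_ne_top fun i _ => ?_
    rw [ENNReal.tsum_mul_left, ENNReal.tsum_geometric]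
    exact ENNReal.mul_ne_top (ENNReal.natCast_ne_top N)
      (ENNReal.inv_ne_top.2 (tsub_pos_of_lt (hr i)).ne')
  have hSm : Measurable fun ω => ∑' n, ∑ k ∈ K n, T n k ω :=
    Measurable.tsum fun n => Finset.measurable_sum _ fun k _ => hTm n k
  filter_upwards [ae_lt_top hSm hSint] with ω hω
  set S := ∑' n, ∑ k ∈ K n, T n k ω with hS
  -- `S` dominates every normalised `2m`-th power, and taking the maximum with `1` gives `S ≤ M ^ (2
  -- * m)` without extracting a root.
  refine ⟨max 1 S.toReal, le_max_of_le_left zero_le_one, fun s t hst => ?_⟩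
  choose n k hk hs ht using hst
  obtain rfl : s = lo n k := funext hs
  obtain rfl : t = hi n k := funext ht
  simp only [hlen]
  change _ ≤ _ * w n
  have hTS : T n k ω ≤ S := by
    refine le_trans ?_ (ENNReal.le_tsum n)
    exact Finset.single_le_sum (f := fun k => T n k ω) (fun _ _ => zero_le)
      (Fintype.mem_piFinset.2 fun i => Finset.mem_range.2 (hk i))
  have hSM : S ≤ ENNReal.ofReal (max 1 S.toReal) ^ (2 * m) := by
    calc S = ENNReal.ofReal S.toReal := (ENNReal.ofReal_toReal hω.ne).symm
      _ ≤ ENNReal.ofReal (max 1 S.toReal) := ENNReal.ofReal_le_ofReal (le_max_right _ _)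
      _ ≤ _ := le_self_pow₀ (by simp) h2m
  have h3 := hTS.trans hSM
  simp only [T] at h3
  rw [← mul_pow] at h3
  have h4 := (ENNReal.pow_right_strictMono h2m).le_iff_le.1 h3
  rw [Real.enorm_eq_ofReal_abs, ← ENNReal.ofReal_mul (abs_nonneg _),
    ENNReal.ofReal_le_ofReal_iff (le_max_of_le_left zero_le_one)] at h4
  rwa [← div_eq_mul_inv, div_le_iff₀ (hw n)] at h4

/-- Almost sure Hölder bounds on dyadic cells, simultaneously for all exponents. -/
lemma ae_forall_dyadicCell_bound {Y : (Fin d → ℝ) → Ω → ℝ}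
    (hY : ∀ t, Measurable (Y t)) {H : Fin d → ℝ} (hH : ∀ i, 0 < H i)
    (hmom : ∀ m : ℕ, m ≠ 0 → ∃ C : ℝ, 0 ≤ C ∧ ∀ s t : Fin d → ℝ, 0 ≤ s → 0 ≤ t →
      eLpNorm (fun ω => rectIncrement (fun u => Y u ω) s t) (2 * m : ℕ) P
        ≤ ENNReal.ofReal (C * ∏ i, |t i - s i| ^ H i)) :
    ∀ᵐ ω ∂P, ∀ δ : Fin d → ℝ, (∀ i, 0 < δ i ∧ δ i < H i) → ∀ N : ℕ, ∃ M : ℝ, 0 ≤ M ∧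
      ∀ s t : Fin d → ℝ, (∀ i, IsDyadicCell N (s i) (t i)) →
        |rectIncrement (fun u => Y u ω) s t| ≤ M * ∏ i, |t i - s i| ^ δ i := by
  -- Exponents increasing to `H` reduce the uncountably many `δ` to a countable intersection of
  -- events; dyadic cells have length at most `1`, so a larger exponent gives a stronger bound.
  let e : ℕ → Fin d → ℝ := fun r i => H i * (1 - 1 / ((r : ℝ) + 1))
  have hlt : ∀ r i, 0 < H i - e r i := by
    intro r i
    have : H i - e r i = H i * (1 / ((r : ℝ) + 1)) := by simp only [e]; ring
    rw [this]
    exact mul_pos (hH i) (by positivity)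
  have hcount : ∀ᵐ ω ∂P, ∀ r N : ℕ, ∃ M : ℝ, 0 ≤ M ∧
      ∀ s t : Fin d → ℝ, (∀ i, IsDyadicCell N (s i) (t i)) →
        |rectIncrement (fun u => Y u ω) s t| ≤ M * ∏ i, |t i - s i| ^ e r i := by
    refine ae_all_iff.2 fun r => ae_all_iff.2 fun N => ?_
    obtain ⟨m, hm0, hm⟩ : ∃ m : ℕ, m ≠ 0 ∧ ∀ i, 1 < ((2 * m : ℕ) : ℝ) * (H i - e r i) := by
      have h1 : ∀ᶠ m : ℕ in atTop, ∀ i, 1 < ((2 * m : ℕ) : ℝ) * (H i - e r i) := by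
        refine eventually_all.2 fun i => ?_
        have : Tendsto (fun m : ℕ => ((2 * m : ℕ) : ℝ) * (H i - e r i)) atTop atTop :=
          (tendsto_natCast_atTop_atTop.comp
            (tendsto_id.const_mul_atTop' (by norm_num : 0 < 2))).atTop_mul_const (hlt r i)
        exact this.eventually_gt_atTop 1
      obtain ⟨m, hm, hm'⟩ := ((eventually_ne_atTop 0).and h1).exists
      exact ⟨m, hm, hm'⟩
    obtain ⟨C, hC0, hC⟩ := hmom m hm0
    exact ae_exists_dyadicCell_bound hY hm0 hm hC0 hC N
  filter_upwards [hcount] with ω hω δ hδ N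
  obtain ⟨r, hr⟩ : ∃ r : ℕ, ∀ i, δ i ≤ e r i := by
    have : ∀ᶠ r : ℕ in atTop, ∀ i, δ i ≤ e r i := by
      refine eventually_all.2 fun i => ?_
      have h1 : Tendsto (fun r : ℕ => e r i) atTop (𝓝 (H i * (1 - 0))) :=
        (tendsto_const_nhds.sub tendsto_one_div_add_atTop_nhds_zero_nat).const_mul _
      rw [sub_zero, mul_one] at h1
      filter_upwards [h1.eventually_const_lt (hδ i).2] with r hr using hr.le
    exact this.exists
  obtain ⟨M, hM0, hM⟩ := hω r N
  refine ⟨M, hM0, fun s t hst => (hM s t hst).trans (mul_le_mul_of_nonneg_left ?_ hM0)⟩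
  refine Finset.prod_le_prod (fun i _ => Real.rpow_nonneg (abs_nonneg _) _) fun i _ => ?_
  obtain ⟨n, k, -, hs, ht⟩ := hst i
  have hlen : |t i - s i| = 1 / 2 ^ n := by
    rw [hs, ht, ← sub_div]; push_cast
    rw [add_sub_cancel_left, abs_of_nonneg (by positivity)]
  rw [hlen]
  refine Real.rpow_le_rpow_of_exponent_ge (by positivity) ?_ (hr i)
  rw [div_le_one (by positivity)]
  exact one_le_pow₀ one_le_two

/-- Mean square continuity along dyadic approximations. -/
lemma tendsto_eLpNorm_dyadicFloor {Y : (Fin d → ℝ) → Ω → ℝ}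
    (hY : ∀ t, Measurable (Y t)) (hY0 : ∀ t ω, (∃ i, t i = 0) → Y t ω = 0)
    {H : Fin d → ℝ} (hH : ∀ i, 0 < H i) {C : ℝ} (hC0 : 0 ≤ C)
    (hC : ∀ s t : Fin d → ℝ, 0 ≤ s → 0 ≤ t →
      eLpNorm (fun ω => rectIncrement (fun u => Y u ω) s t) 2 P
        ≤ ENNReal.ofReal (C * ∏ i, |t i - s i| ^ H i)) {t : Fin d → ℝ} (ht : 0 ≤ t) :
    Tendsto (fun n => eLpNorm (Y (dyadicFloor n t) - Y t) 2 P) atTop (𝓝 0) := by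
  set N := ∑ i, |t i| with hN
  have htN : ∀ i, t i ≤ N := fun i => (le_abs_self _).trans
    (Finset.single_le_sum (f := fun i => |t i|) (fun _ _ => abs_nonneg _) (Finset.mem_univ i))
  have hle : ∀ n, eLpNorm (Y (dyadicFloor n t) - Y t) 2 P
      ≤ ∑ i, ENNReal.ofReal (C * ((∏ l ∈ Finset.univ.erase i, N ^ H l) *
        |t i - dyadicFloor n t i| ^ H i)) := by
    intro n
    set s := dyadicFloor n t with hs
    have hs0 : 0 ≤ s := dyadicFloor_nonneg n t
    rw [eLpNorm_sub_comm]
    have hrw : Y t - Y s = ∑ i, fun ω => rectIncrement (fun u => Y u ω)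
        (Function.update 0 i (s i)) (Function.update (hybridPoint s t i) i (t i)) := by
      ext ω
      rw [Finset.sum_apply]
      exact sub_eq_sum_rectIncrement (fun u hu => hY0 u ω hu) s t
    rw [hrw]
    refine (eLpNorm_sum_le (fun i _ =>
      (measurable_rectIncrement hY _ _).aestronglyMeasurable) (by norm_num)).trans ?_
    refine Finset.sum_le_sum fun i _ => ?_
    refine (hC _ _ (fun l => ?_) (fun l => ?_)).trans
      (ENNReal.ofReal_le_ofReal (mul_le_mul_of_nonneg_left ?_ hC0))
    · by_cases hl : l = i
      · subst hl; simpa using hs0 l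
      · simp [hl]
    · by_cases hl : l = i
      · subst hl; simpa using ht l
      · simp only [Function.update_of_ne hl, hybridPoint]
        split_ifs
        · exact ht l
        · exact hs0 l
    · exact prod_abs_hybridPoint_le (fun i => (hH i).le)
        (fun l => ⟨hs0 l, (dyadicFloor_le n ht l).trans (htN l)⟩) (fun l => ⟨ht l, htN l⟩) i
  refine tendsto_of_tendsto_of_tendsto_of_le_of_le tendsto_const_nhds ?_ (fun _ => zero_le) hle
  have hlim : Tendsto (fun n => ∑ i, ENNReal.ofReal (C * ((∏ l ∈ Finset.univ.erase i, N ^ H l) *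
      |t i - dyadicFloor n t i| ^ H i))) atTop
      (𝓝 (∑ i, ENNReal.ofReal (C * ((∏ l ∈ Finset.univ.erase i, N ^ H l) *
        |t i - t i| ^ H i)))) := by
    refine tendsto_finsetSum _ fun i _ => ENNReal.tendsto_ofReal ?_
    refine Tendsto.const_mul _ (Tendsto.const_mul _ ?_)
    exact Tendsto.rpow_const (tendsto_const_nhds.sub (tendsto_dyadicFloor ht i)).abs
      (Or.inr (hH i).le)
  simpa [Real.zero_rpow (hH _).ne'] using hlim

/-- A Kolmogorov continuity theorem for rectangular increments. -/
theorem exists_holder_modification [IsFiniteMeasure P] {Y : (Fin d → ℝ) → Ω → ℝ}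
    (hY : ∀ t, Measurable (Y t)) (hY0 : ∀ t ω, (∃ i, t i = 0) → Y t ω = 0)
    {H : Fin d → ℝ} (hH : ∀ i, 0 < H i)
    (hmom : ∀ m : ℕ, m ≠ 0 → ∃ C : ℝ, 0 ≤ C ∧ ∀ s t : Fin d → ℝ, 0 ≤ s → 0 ≤ t →
      eLpNorm (fun ω => rectIncrement (fun u => Y u ω) s t) (2 * m : ℕ) P
        ≤ ENNReal.ofReal (C * ∏ i, |t i - s i| ^ H i)) :
    ∃ Z' : (Fin d → ℝ) → Ω → ℝ,
      (∀ t, 0 ≤ t → Measurable (Z' t)) ∧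
      (∀ t, 0 ≤ t → ∀ᵐ ω ∂P, Z' t ω = Y t ω) ∧
      (∀ ω, ContinuousOn (fun t => Z' t ω) {t | 0 ≤ t}) ∧
      ∀ δ : Fin d → ℝ, (∀ i, 0 ≤ δ i ∧ δ i < H i) →
        ∀ ω, ∀ N : ℝ, 0 < N → ∃ C : ℝ, 0 < C ∧
          ∀ s t : Fin d → ℝ, (∀ i, 0 ≤ s i ∧ s i ≤ N) → (∀ i, 0 ≤ t i ∧ t i ≤ N) →
            |rectIncrement (fun u => Z' u ω) s t| ≤ C * ∏ i, |t i - s i| ^ δ i := by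
  classical
  have hae := ae_forall_dyadicCell_bound hY hH hmom
  -- The bad event need not be measurable. The process is set to `0` on a measurable null set
  -- containing it, which keeps it measurable and gives the bounds for every `ω`.
  obtain ⟨B, hBsub, hBm, hB0⟩ := exists_measurable_superset_of_null (ae_iff.1 hae)
  have hgood : ∀ ω ∉ B, ∃ X' : (Fin d → ℝ) → ℝ,
      (∀ t, 0 ≤ t → Tendsto (fun n => Y (dyadicFloor n t) ω) atTop (𝓝 (X' t))) ∧
      ContinuousOn X' {t | 0 ≤ t} ∧
      ∀ δ : Fin d → ℝ, (∀ i, 0 ≤ δ i ∧ δ i < H i) → ∀ N : ℝ, 0 < N → ∃ C : ℝ, 0 < C ∧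
          ∀ s t : Fin d → ℝ, (∀ i, 0 ≤ s i ∧ s i ≤ N) → (∀ i, 0 ≤ t i ∧ t i ≤ N) →
            |rectIncrement X' s t| ≤ C * ∏ i, |t i - s i| ^ δ i := by
    intro ω hω
    refine exists_continuous_extension hH (X := fun u => Y u ω) (fun u hu => hY0 u ω hu) ?_
    by_contra hcon
    exact hω (hBsub hcon)
  choose! X' hlim hcont hholder using hgood
  have hB : ∀ᵐ ω ∂P, ω ∉ B := measure_eq_zero_iff_ae_notMem.1 hB0
  refine ⟨fun t ω => if ω ∈ B then 0 else X' ω t, fun t ht => ?_, fun t ht => ?_, fun ω => ?_,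
    fun δ hδ ω N hN => ?_⟩
  · refine measurable_of_tendsto_metrizable
      (f := fun n ω => if ω ∈ B then 0 else Y (dyadicFloor n t) ω)
      (fun n => Measurable.ite hBm measurable_const (hY _)) (tendsto_pi_nhds.2 fun ω => ?_)
    by_cases hω : ω ∈ B
    · simp [hω]
    · simpa [hω] using hlim ω hω t ht
  · obtain ⟨C, hC0, hC⟩ := hmom 1 one_ne_zero
    -- Along dyadic approximations `Y` converges pathwise to the extension and in mean square to `Y
    -- t`; an almost surely convergent subsequence identifies the two limits.
    have hL2 := tendsto_eLpNorm_dyadicFloor hY hY0 hH hC0 (by simpa using hC) ht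
    obtain ⟨ns, hns, hsub⟩ := (tendstoInMeasure_of_tendsto_eLpNorm (by simp)
      (fun n => (hY _).aestronglyMeasurable) (hY t).aestronglyMeasurable
      hL2).exists_seq_tendsto_ae
    filter_upwards [hB, hsub] with ω hω hωlim
    rw [if_neg hω]
    exact tendsto_nhds_unique ((hlim ω hω t ht).comp hns.tendsto_atTop) hωlim
  · by_cases hω : ω ∈ B
    · simpa [hω] using continuousOn_const
    · simpa [hω] using hcont ω hω
  · by_cases hω : ω ∈ B
    · refine ⟨1, one_pos, fun s t _ _ => ?_⟩
      simp only [hω, if_true, rectIncrement, mul_zero, Finset.sum_const_zero, abs_zero, one_mul]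
      exact Finset.prod_nonneg fun i _ => Real.rpow_nonneg (abs_nonneg _) _
    · simpa only [hω, if_false] using hholder ω hω δ hδ N hN

end Modification

theorem proposition3 {Ω : Type*} [MeasurableSpace Ω] (P : Measure Ω) [IsProbabilityMeasure P]
    (d q : ℕ) (hd : 1 ≤ d) (hq : 1 ≤ q)
    (H : Fin d → ℝ) (hH : ∀ i, 1 / 2 < H i ∧ H i < 1)
    (c : ℝ) (hc : 0 < c)
    (W : (Fin d → ℝ) → Ω → ℝ) (hW : IsBrownianSheet W P)
    (Z : (Fin d → ℝ) → Ω → ℝ) (hZ : IsHermiteSheet W P q H c Z) :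
    ∃ Z' : (Fin d → ℝ) → Ω → ℝ,
      (∀ t, 0 ≤ t → Measurable (Z' t)) ∧
      (∀ t, 0 ≤ t → ∀ᵐ ω ∂P, Z' t ω = Z t ω) ∧
      (∀ ω, ContinuousOn (fun t => Z' t ω) {t | 0 ≤ t}) ∧
      ∀ δ : Fin d → ℝ, (∀ i, 0 ≤ δ i ∧ δ i < H i) →
        ∀ ω, ∀ N : ℝ, 0 < N → ∃ C : ℝ, 0 < C ∧
          ∀ s t : Fin d → ℝ, (∀ i, 0 ≤ s i ∧ s i ≤ N) → (∀ i, 0 ≤ t i ∧ t i ≤ N) →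
            |rectIncrement (fun u => Z' u ω) s t| ≤ C * ∏ i, |t i - s i| ^ δ i := by
  obtain ⟨Y, hYm, hYZ, hY0, hmom⟩ := hZ.exists_version hq hH hW
  obtain ⟨Z', hm, hae, hcont, hholder⟩ := exists_holder_modification hYm hY0
    (fun i => by linarith [(hH i).1]) hmom
  refine ⟨Z', hm, fun t ht => ?_, hcont, hholder⟩
  filter_upwards [hae t ht, hYZ t ht] with ω h1 h2
  rw [h1, h2]
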